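/- Let $k$ be a field of characteristic zero. Let $\mathrm{Ass}_n$ be the degree completion of the free associative $k$-algebra on $x_1,\dots,x_n$ (for $n=2,3$ we write $x,y,z$), and let $\mathfrak{lie}_n\subset \mathrm{Ass}_n$ be the degree completion of the free Lie algebra on the same generators. Define $\partial_i$ on $\mathrm{Ass}_n$ by $a=a_0+\sum_i(\partial_i a)x_i$ with $a_0\in k$. Let $\mathfrak{tr}_n$ be the quotient of the space of series without constant term in $\mathrm{Ass}_n$ by the span of all commutators $ab-ba$, $a,b\in\mathrm{Ass}_n$, and let $\mathrm{Tr}:\mathrm{Ass}_n\to\mathfrak{tr}_n$ be the projection (zero on constants). Let $\mathrm{ch}(x,y)=\ln(e^xe^y)\in\mathrm{Ass}_2$. Define $\delta:\mathfrak{tr}_2\to\mathfrak{tr}_3$ and $\tilde\delta:\mathfrak{tr}_1\to\mathfrak{tr}_2$ by $$(\delta f)(x,y,z)=f(y,z)-f(x+y,z)+f(x,y+z)-f(x,y),\qquad (\tilde\delta f)(x,y)=f(y)-f(\mathrm{ch}(x,y))+f(x).$$ A tangential derivation of $\mathfrak{lie}_2$ is a derivation $u$ with $u(x)=[x,a]$,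 $u(y)=[y,b]$ for some $a,b\in\mathfrak{lie}_2$; $a$ and $b$ are unique once normalized so that $a$ has no term in $x$ and $b$ has no term in $y$. Such a $u$ acts on $\mathrm{Ass}_2$ and $\mathfrak{tr}_2$. Its divergence is $\mathrm{div}(u)=\mathrm{Tr}(x\,\partial_x a+y\,\partial_y b)\in\mathfrak{tr}_2$ (with $a,b$ normalized). Let $\exp(u)=\sum_{r\ge 0}u^r/r!$, let $\mathrm{TAut}_2$ be the group, under composition, of the automorphisms $\exp(u)$ with $u$ a tangential derivation, and set $$j(\exp(u))=\frac{e^u-1}{u}\cdot\mathrm{div}(u)=\sum_{r\ge0}\frac{1}{(r+1)!}\,u^r\cdot\mathrm{div}(u)\in\mathfrak{tr}_2 .$$ Let $$\mathfrak{hkv}_2=\{u \text{ a tangential derivation of } \mathfrak{lie}_2:\ u(x+y)=0,\ \mathrm{div}(u)\in\ker\delta\},\qquad \mathrm{HKV}_2=\exp(\mathfrak{hkv}_2),$$ $$\mathrm{Sol}(\mathrm{HKV})=\{F\in\mathrm{TAut}_2:\ F(x+y)=\mathrm{ch}(x,y),\ j(F)\in\mathrm{im}\,\tilde\delta\}.$$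 **Theorem.** Assume that $\mathrm{Sol}(\mathrm{HKV})$ is nonempty. Then $\mathrm{HKV}_2$ is a group under composition, and it acts on $\mathrm{Sol}(\mathrm{HKV})$ by multiplication on the right, $F\mapsto Fg$. This action is free and transitive. -/

import Mathlib

noncomputable section

namespace KashiwaraVergne

/-- `Ass k n` is the degree completion of the free associative algebra over `k` on `n` generators:
formal (infinite) linear combinations of words in the letters `Fin n`, a series being given by
its coefficients. -/
@[ext] structure Ass (k : Type*) (n : ℕ) where
  /-- The coefficient of a word. -/
  coeff : List (Fin n) → k

instance {k : Type*} {n : ℕ} : CoeFun (Ass k n) fun _ => List (Fin n) → k := ⟨Ass.coeff⟩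

section Algebra

variable {k : Type*} [Field k] {m n : ℕ}

instance : Zero (Ass k n) := ⟨⟨fun _ => 0⟩⟩
instance : Add (Ass k n) := ⟨fun f g => ⟨fun w => f w + g w⟩⟩
instance : Neg (Ass k n) := ⟨fun f => ⟨fun w => -f w⟩⟩
instance : Sub (Ass k n) := ⟨fun f g => ⟨fun w => f w - g w⟩⟩
instance : SMul k (Ass k n) := ⟨fun c f => ⟨fun w => c * f w⟩⟩
instance : SMul ℕ (Ass k n) := ⟨fun c f => ⟨fun w => c • f w⟩⟩
instance : SMul ℤ (Ass k n) := ⟨fun c f => ⟨fun w => c • f w⟩⟩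

theorem Ass.coeff_injective {k : Type*} {n : ℕ} :
    Function.Injective (Ass.coeff : Ass k n → List (Fin n) → k) := fun _ _ h => Ass.ext h

instance : AddCommGroup (Ass k n) :=
  Ass.coeff_injective.addCommGroup _ rfl (fun _ _ => rfl) (fun _ => rfl) (fun _ _ => rfl)
    (fun _ _ => rfl) (fun _ _ => rfl)

/-- The coefficients, as an additive homomorphism. -/
def Ass.coeffHom : Ass k n →+ (List (Fin n) → k) where
  toFun := Ass.coeff
  map_zero' := rfl
  map_add' _ _ := rfl

instance : Module k (Ass k n) :=
  Ass.coeff_injective.module k Ass.coeffHom (fun _ _ => rfl)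

@[simp] theorem Ass.add_apply (f g : Ass k n) (w : List (Fin n)) : (f + g) w = f w + g w := rfl
@[simp] theorem Ass.sub_apply (f g : Ass k n) (w : List (Fin n)) : (f - g) w = f w - g w := rfl
@[simp] theorem Ass.zero_apply (w : List (Fin n)) : (0 : Ass k n) w = 0 := rfl
@[simp] theorem Ass.neg_apply (f : Ass k n) (w : List (Fin n)) : (-f) w = -f w := rfl
@[simp] theorem Ass.smul_apply (c : k) (f : Ass k n) (w : List (Fin n)) :
    (c • f) w = c * f w := rfl

theorem Ass.sum_apply {ι : Type*} (s : Finset ι) (g : ι → Ass k n) (w : List (Fin n)) :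
    (∑ i ∈ s, g i) w = ∑ i ∈ s, g i w := by
  have := congrFun (map_sum Ass.coeffHom g s) w
  rwa [Finset.sum_apply] at this

/-- The unit series. -/
instance : One (Ass k n) := ⟨⟨fun w => if w = [] then 1 else 0⟩⟩

/-- Concatenation product: the coefficient of `w` in `f * g` is the sum of `f u * g v` over all
factorizations `w = u v`. -/
instance : Mul (Ass k n) :=
  ⟨fun f g => ⟨fun w => ∑ i ∈ Finset.range (w.length + 1), f (w.take i) * g (w.drop i)⟩⟩

theorem Ass.one_apply (w : List (Fin n)) : (1 : Ass k n) w = if w = [] then 1 else 0 := rfl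

theorem Ass.mul_apply (f g : Ass k n) (w : List (Fin n)) :
    (f * g) w = ∑ i ∈ Finset.range (w.length + 1), f (w.take i) * g (w.drop i) := rfl

/-- Removal of a given first letter. -/
def Ass.lshift (a : Fin n) (f : Ass k n) : Ass k n := ⟨fun w => f (a :: w)⟩

@[simp] theorem Ass.mul_nil (f g : Ass k n) : (f * g) [] = f [] * g [] := by
  simp [Ass.mul_apply]

theorem Ass.mul_cons (f g : Ass k n) (a : Fin n) (w : List (Fin n)) :
    (f * g) (a :: w) = f [] * g (a :: w) + (Ass.lshift a f * g) w := by
  simp only [Ass.mul_apply, List.length_cons]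
  rw [Finset.sum_range_succ', add_comm]
  simp [Ass.lshift]

theorem Ass.add_mul' (f g h : Ass k n) : (f + g) * h = f * h + g * h := by
  ext w; simp [Ass.mul_apply, add_mul, Finset.sum_add_distrib]

theorem Ass.mul_add' (f g h : Ass k n) : f * (g + h) = f * g + f * h := by
  ext w; simp [Ass.mul_apply, mul_add, Finset.sum_add_distrib]

theorem Ass.smul_mul' (c : k) (f g : Ass k n) : (c • f) * g = c • (f * g) := by
  ext w; simp [Ass.mul_apply, mul_assoc, Finset.mul_sum]

theorem Ass.mul_smul' (c : k) (f g : Ass k n) : f * (c • g) = c • (f * g) := by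
  ext w; simp [Ass.mul_apply, mul_left_comm, Finset.mul_sum]

theorem Ass.lshift_mul (f g : Ass k n) (a : Fin n) :
    Ass.lshift a (f * g) = f [] • Ass.lshift a g + Ass.lshift a f * g := by
  ext w; exact Ass.mul_cons f g a w

theorem Ass.zero_mul' (f : Ass k n) : 0 * f = 0 := by
  ext w; simp [Ass.mul_apply]

theorem Ass.lshift_one (a : Fin n) : Ass.lshift a (1 : Ass k n) = 0 := by
  ext w; simp [Ass.lshift, Ass.one_apply]

theorem Ass.mul_assoc' (f g h : Ass k n) : f * g * h = f * (g * h) := by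
  ext w
  induction w generalizing f with
  | nil => simp [mul_assoc]
  | cons a w ih =>
    rw [Ass.mul_cons, Ass.lshift_mul, Ass.add_mul', Ass.smul_mul', Ass.add_apply, Ass.smul_apply,
      ih, Ass.mul_cons f, Ass.mul_cons g, Ass.mul_nil]
    ring

theorem Ass.one_mul' (f : Ass k n) : 1 * f = f := by
  ext w
  cases w with
  | nil => simp [Ass.one_apply]
  | cons a w => rw [Ass.mul_cons, Ass.lshift_one, Ass.zero_mul']; simp [Ass.one_apply]

theorem Ass.mul_one' (f : Ass k n) : f * 1 = f := by
  ext w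
  induction w generalizing f with
  | nil => simp [Ass.one_apply]
  | cons a w ih => rw [Ass.mul_cons, ih]; simp [Ass.one_apply, Ass.lshift]

instance : Ring (Ass k n) where
  __ := (inferInstance : AddCommGroup (Ass k n))
  mul_assoc := Ass.mul_assoc'
  one_mul := Ass.one_mul'
  mul_one := Ass.mul_one'
  left_distrib := Ass.mul_add'
  right_distrib := Ass.add_mul'
  zero_mul := Ass.zero_mul'
  mul_zero f := by ext w; simp [Ass.mul_apply]

instance : Algebra k (Ass k n) := Algebra.ofModule Ass.smul_mul' (fun c f g => Ass.mul_smul' c f g)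

/-- The commutator bracket `[f, g] = f g - g f`. -/
instance : LieRing (Ass k n) := LieRing.ofAssociativeRing

/-- The generators `x_1, …, x_n`. -/
def X (i : Fin n) : Ass k n := ⟨fun w => if w = [i] then 1 else 0⟩

/-- The homogeneous component of degree `d`. -/
def homog (d : ℕ) (f : Ass k n) : Ass k n := ⟨fun w => if w.length = d then f w else 0⟩

/-- The operator `∂_i` determined by `f = f₀ + ∑ i, (∂_i f) x_i`. -/
def partialR (i : Fin n) (f : Ass k n) : Ass k n := ⟨fun w => f (w ++ [i])⟩

variable (k n) in
/-- `lie_n`, the degree completion of the free Lie algebra on `x_1, …, x_n`, realized in `Ass_n`.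
The free Lie algebra is the Lie subalgebra of Lie polynomials, generated by the letters for
the commutator bracket; the completion consists of the series all of whose homogeneous components
are Lie polynomials. -/
def lie : Set (Ass k n) :=
  {f | ∀ d, homog d f ∈ LieSubalgebra.lieSpan k (Ass k n) (Set.range (X : Fin n → Ass k n))}

end Algebra

section Series

variable {k : Type*} [Field k] {m n : ℕ}

/-- For a series `f` without constant term, the sum `∑ c_r f ^ r` over all `r ≥ 0`; the terms
with `r > length w` do not contribute to the coefficient of `w`. -/
def evalSeries (c : ℕ → k) (f : Ass k n) : Ass k n :=
  ⟨fun w => ∑ r ∈ Finset.range (w.length + 1), c r * (f ^ r) w⟩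

/-- `e ^ f = ∑ f ^ r / r!`, for `f` without constant term. -/
def assExp (f : Ass k n) : Ass k n := evalSeries (fun r => (r.factorial : k)⁻¹) f

/-- `ln g = - ∑_{r ≥ 1} (1 - g) ^ r / r`, for `g` with constant term `1`. -/
def assLog (g : Ass k n) : Ass k n := - evalSeries (fun r => (r : k)⁻¹) (1 - g)

variable (k) in
/-- The Campbell–Hausdorff series `ch(x, y) = ln (e ^ x e ^ y)`. -/
def ch : Ass k 2 := assLog (assExp (X 0) * assExp (X 1))

/-- The product `s_{w_1} ⋯ s_{w_r}` for a word `w = w_1 ⋯ w_r`. -/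
def wordProd (s : Fin m → Ass k n) (w : List (Fin m)) : Ass k n := (w.map s).prod

theorem mul_apply_eq_zero {f g : Ass k n} {p q : ℕ} (hf : ∀ w, w.length < p → f w = 0)
    (hg : ∀ w, w.length < q → g w = 0) (w : List (Fin n)) (hw : w.length < p + q) :
    (f * g) w = 0 := by
  rw [Ass.mul_apply]
  refine Finset.sum_eq_zero fun i hi => ?_
  by_cases h : (w.take i).length < p
  · rw [hf _ h, zero_mul]
  · rw [hg, mul_zero]
    simp only [List.length_take, List.length_drop] at *
    omega

theorem wordProd_apply_eq_zero {s : Fin m → Ass k n} (hs : ∀ i, s i [] = 0) (v : List (Fin m))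
    (w : List (Fin n)) (h : w.length < v.length) : wordProd s v w = 0 := by
  induction v generalizing w with
  | nil => simp at h
  | cons a v ih =>
    have : wordProd s (a :: v) = s a * wordProd s v := by simp [wordProd]
    rw [this]
    refine mul_apply_eq_zero (p := 1) (q := v.length) ?_ ih w (by simp at h; omega)
    intro w hw
    have : w = [] := List.length_eq_zero_iff.1 (by omega)
    rw [this, hs]

/-- All words of length at most `N`. -/
def wordsLE (m N : ℕ) : Finset (List (Fin m)) :=
  (Finset.range (N + 1)).biUnion fun r => Finset.univ.image (List.ofFn : (Fin r → Fin m) → _)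

theorem mem_wordsLE {N : ℕ} {w : List (Fin m)} : w ∈ wordsLE m N ↔ w.length ≤ N := by
  simp only [wordsLE, Finset.mem_biUnion, Finset.mem_range, Finset.mem_image, Finset.mem_univ,
    true_and]
  constructor
  · rintro ⟨r, hr, v, rfl⟩
    simp; omega
  · intro h
    exact ⟨w.length, by omega, w.get, List.ofFn_get w⟩

/-- The substitution `f ↦ f(s_1, …, s_m)` for series `s_i` without constant term; words longer than
`w` do not contribute to the coefficient of `w`. -/
def substFun (s : Fin m → Ass k n) (f : Ass k m) : Ass k n :=
  ⟨fun w => ∑ v ∈ wordsLE m w.length, f v * wordProd s v w⟩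

theorem substFun_apply {s : Fin m → Ass k n} (hs : ∀ i, s i [] = 0) (f : Ass k m)
    (w : List (Fin n)) {N : ℕ} (hN : w.length ≤ N) :
    substFun s f w = ∑ v ∈ wordsLE m N, f v * wordProd s v w := by
  refine Finset.sum_subset (fun v hv => ?_) (fun v _ hv => ?_)
  · rw [mem_wordsLE] at *; omega
  · rw [mem_wordsLE] at hv
    rw [wordProd_apply_eq_zero hs _ _ (by omega), mul_zero]

theorem substFun_mul {s : Fin m → Ass k n} (hs : ∀ i, s i [] = 0) (f g : Ass k m) :
    substFun s (f * g) = substFun s f * substFun s g := by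
  ext w
  have key : ∀ v₁ v₂ : List (Fin m), wordProd s (v₁ ++ v₂) = wordProd s v₁ * wordProd s v₂ := by
    intro v₁ v₂; simp [wordProd]
  have h1 : substFun s (f * g) w = ∑ p ∈ wordsLE m w.length ×ˢ wordsLE m w.length,
      f p.1 * g p.2 * wordProd s (p.1 ++ p.2) w := by
    have : ∀ v ∈ wordsLE m w.length, (f * g) v * wordProd s v w =
        ∑ p ∈ (wordsLE m w.length ×ˢ wordsLE m w.length) with p.1 ++ p.2 = v,
          f p.1 * g p.2 * wordProd s (p.1 ++ p.2) w := by
      intro v hv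
      rw [mem_wordsLE] at hv
      rw [Ass.mul_apply, Finset.sum_mul]
      refine Finset.sum_bij' (fun i _ => (v.take i, v.drop i)) (fun p _ => p.1.length) ?_ ?_ ?_ ?_ ?_
      · intro i hi
        simp only [Finset.mem_filter, Finset.mem_product, mem_wordsLE, List.take_append_drop,
          List.length_take, List.length_drop, and_true]
        omega
      · rintro ⟨a, b⟩ hp
        simp only [Finset.mem_filter, Finset.mem_product, mem_wordsLE] at hp
        have := congrArg List.length hp.2
        simp only [List.length_append] at this
        simp only [Finset.mem_range]; omega
      · intro i hi
        simp only [Finset.mem_range] at hi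
        simp; omega
      · rintro ⟨a, b⟩ hp
        simp only [Finset.mem_filter] at hp
        simp [← hp.2]
      · intro i hi
        simp
    rw [show substFun s (f * g) w = ∑ v ∈ wordsLE m w.length, (f * g) v * wordProd s v w from rfl,
      Finset.sum_congr rfl this, Finset.sum_fiberwise_eq_sum_filter
      (wordsLE m w.length ×ˢ wordsLE m w.length) (wordsLE m w.length)]
    refine Finset.sum_subset (Finset.filter_subset _ _) fun p hp hp' => ?_
    have : w.length < (p.1 ++ p.2).length := by
      by_contra hlt
      exact hp' (Finset.mem_filter.2 ⟨hp, mem_wordsLE.2 (by omega)⟩)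
    rw [wordProd_apply_eq_zero hs _ _ this, mul_zero]
  rw [h1, Ass.mul_apply]
  have h2 : ∀ i ∈ Finset.range (w.length + 1), substFun s f (w.take i) * substFun s g (w.drop i) =
      ∑ p ∈ wordsLE m w.length ×ˢ wordsLE m w.length,
        f p.1 * g p.2 * (wordProd s p.1 (w.take i) * wordProd s p.2 (w.drop i)) := by
    intro i _
    rw [substFun_apply hs f (w.take i) (N := w.length) (by simp),
      substFun_apply hs g (w.drop i) (N := w.length) (by simp), Finset.sum_mul_sum,
      Finset.sum_product]
    exact Finset.sum_congr rfl fun _ _ => Finset.sum_congr rfl fun _ _ => by ring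
  rw [Finset.sum_congr rfl h2, Finset.sum_comm]
  refine Finset.sum_congr rfl fun p _ => ?_
  rw [key, Ass.mul_apply, Finset.mul_sum]

theorem substFun_one (s : Fin m → Ass k n) : substFun s 1 = 1 := by
  ext w
  rw [show substFun s 1 w = ∑ v ∈ wordsLE m w.length, (1 : Ass k m) v * wordProd s v w from rfl,
    Finset.sum_eq_single []]
  · simp [wordProd, Ass.one_apply]
  · intro v _ hv; simp [Ass.one_apply, hv]
  · intro h; exact absurd (mem_wordsLE.2 (by simp)) h

/-- Substitution of series without constant term, as an algebra homomorphism. -/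
def subst (s : Fin m → Ass k n) (hs : ∀ i, s i [] = 0) : Ass k m →ₐ[k] Ass k n :=
  AlgHom.ofLinearMap
    { toFun := substFun s
      map_add' := fun f g => by ext w; simp [substFun, add_mul, Finset.sum_add_distrib]
      map_smul' := fun c f => by ext w; simp [substFun, mul_assoc, Finset.mul_sum] }
    (substFun_one s) (substFun_mul hs)

theorem X_nil (i : Fin n) : (X i : Ass k n) [] = 0 := by simp [X]

theorem ch_nil : ch k [] = 0 := by
  simp [ch, assLog, evalSeries]

end Series

section Trace

variable {k : Type*} [Field k] {m n : ℕ}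

variable (k n) in
/-- The span of the commutators and of the constants. -/
def trKer : Submodule k (Ass k n) :=
  Submodule.span k ({1} ∪ {c | ∃ a b : Ass k n, c = a * b - b * a})

variable (k n) in
/-- `tr_n`, the quotient of `Ass_n⁺` (series without constant term) by the span of the commutators,
written as the quotient of `Ass_n = k ⊕ Ass_n⁺` by the constants and the span of the commutators. -/
abbrev tr : Type _ := Ass k n ⧸ trKer k n

/-- The projection `Tr : Ass_n → tr_n`. -/
def Tr : Ass k n →ₗ[k] tr k n := (trKer k n).mkQ

/-- The map `tr_m → tr_n` induced by an algebra homomorphism. -/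
def trMap (φ : Ass k m →ₐ[k] Ass k n) : tr k m →ₗ[k] tr k n :=
  (trKer k m).mapQ (trKer k n) φ.toLinearMap <| by
    rw [trKer, Submodule.span_le]
    rintro c (rfl | ⟨a, b, rfl⟩)
    · exact Submodule.subset_span (Or.inl (map_one φ))
    · exact Submodule.subset_span (Or.inr ⟨φ a, φ b, by simp⟩)

variable (k) in
/-- `δ : tr_2 → tr_3`, `(δ f)(x, y, z) = f(y, z) - f(x + y, z) + f(x, y + z) - f(x, y)`. -/
def delta : tr k 2 →ₗ[k] tr k 3 :=
  trMap (subst ![X 1, X 2] (by simp [Fin.forall_fin_two, X_nil]))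
    - trMap (subst ![X 0 + X 1, X 2] (by simp [Fin.forall_fin_two, X_nil]))
    + trMap (subst ![X 0, X 1 + X 2] (by simp [Fin.forall_fin_two, X_nil]))
    - trMap (subst ![X 0, X 1] (by simp [Fin.forall_fin_two, X_nil]))

variable (k) in
/-- `δ̃ : tr_1 → tr_2`, `(δ̃ f)(x, y) = f(y) - f(ch(x, y)) + f(x)`. -/
def deltaTilde : tr k 1 →ₗ[k] tr k 2 :=
  trMap (subst ![X 1] (by simp [X_nil]))
    - trMap (subst ![ch k] (by simp [ch_nil]))
    + trMap (subst ![X 0] (by simp [X_nil]))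

end Trace

section Derivations

variable (k : Type*) [Field k] (n : ℕ)

/-- A tangential derivation of `lie_n`, given together with its (automatically continuous, and
unique) extension to a derivation of `Ass_n`: `u(x_i) = [x_i, a_i]` with `a_i ∈ lie_n`. The tuple
`(a_1, …, a_n)` is normalized (`a_i` has no term in `x_i`), so that it is determined by `u`. -/
@[ext] structure TDer where
  /-- The derivation, acting on `Ass_n`. -/
  toEnd : Module.End k (Ass k n)
  /-- The components `a_1, …, a_n`. -/
  comp : Fin n → Ass k n
  leibniz : ∀ f g, toEnd (f * g) = toEnd f * g + f * toEnd g
  comp_mem : ∀ i, comp i ∈ lie k n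
  normalized : ∀ i, comp i [i] = 0
  map_X : ∀ i, toEnd (X i) = X i * comp i - comp i * X i

variable {k n}

/-- The operator `∑ c_r D ^ r` over all `r ≥ 0`, for an operator `D` on `Ass_n` which raises
the degree by at least one; the terms with `r > length w` do not contribute to the coefficient
of `w`. -/
def opSeries (c : ℕ → k) (D : Module.End k (Ass k n)) : Module.End k (Ass k n) where
  toFun f := ⟨fun w => ∑ r ∈ Finset.range (w.length + 1), c r * ((D ^ r) f) w⟩
  map_add' f g := by
    ext w
    simp [mul_add, Finset.sum_add_distrib]
  map_smul' c f := by
    ext w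
    simp [mul_left_comm, Finset.mul_sum]

namespace TDer

theorem comp_nil (u : TDer k n) (i : Fin n) : u.comp i [] = 0 := by
  have key : LieSubalgebra.lieSpan k (Ass k n) (Set.range X) ≤
      { carrier := {f : Ass k n | f [] = 0}
        add_mem' := fun {a b} ha hb => by
          simp only [Set.mem_ofPred_eq] at *; rw [Ass.add_apply, ha, hb, add_zero]
        zero_mem' := rfl
        smul_mem' := fun c f hf => by
          simp only [Set.mem_ofPred_eq] at *; rw [Ass.smul_apply, hf, mul_zero]
        lie_mem' := fun {a b} _ _ => by
          change (a * b - b * a) [] = 0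
          rw [Ass.sub_apply, Ass.mul_nil, Ass.mul_nil, mul_comm, sub_self] } := by
    rw [LieSubalgebra.lieSpan_le]
    rintro _ ⟨i, rfl⟩
    exact X_nil i
  have : homog 0 (u.comp i) [] = 0 := key (u.comp_mem i 0)
  simpa [homog] using this

/-- Tangential derivations raise the degree. -/
theorem toEnd_apply_eq_zero (u : TDer k n) (f : Ass k n) (p : ℕ)
    (hf : ∀ w, w.length < p → f w = 0) (w : List (Fin n)) (hw : w.length < p + 1) :
    u.toEnd f w = 0 := by
  have h1 : u.toEnd 1 = 0 := by simpa using u.leibniz 1 1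
  have hX : ∀ i v, v.length < 1 → (X i : Ass k n) v = 0 := by
    intro i v hv
    rw [List.length_eq_zero_iff.1 (by omega : v.length = 0), X_nil]
  have ha : ∀ i v, v.length < 1 → u.comp i v = 0 := by
    intro i v hv
    rw [List.length_eq_zero_iff.1 (by omega : v.length = 0), u.comp_nil]
  have hdX : ∀ i v, v.length < 2 → u.toEnd (X i) v = 0 := by
    intro i v hv
    rw [u.map_X, Ass.sub_apply, mul_apply_eq_zero (hX i) (ha i) v hv,
      mul_apply_eq_zero (ha i) (hX i) v hv, sub_zero]
  have hdec : ∀ f : Ass k n, f = f [] • 1 + ∑ i, X i * Ass.lshift i f := by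
    intro f
    have hsh : ∀ i j : Fin n, Ass.lshift j (X i : Ass k n) = if i = j then 1 else 0 := by
      intro i j
      ext v
      by_cases h : i = j
      · subst h; simp [Ass.lshift, X, Ass.one_apply]
      · simp [Ass.lshift, X, h, Ne.symm h]
    ext v
    rw [Ass.add_apply, Ass.smul_apply, Ass.sum_apply, Ass.one_apply]
    cases v with
    | nil => simp [X_nil]
    | cons a v =>
      simp only [Ass.mul_cons, hsh, X_nil]
      rw [Finset.sum_eq_single a]
      · simp [Ass.lshift]
      · intro b _ hb; simp [hb]
      · simp
  have hD : ∀ f : Ass k n, u.toEnd f =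
      ∑ i, (u.toEnd (X i) * Ass.lshift i f + X i * u.toEnd (Ass.lshift i f)) := by
    intro f
    conv_lhs => rw [hdec f]
    rw [map_add, map_smul, h1, smul_zero, zero_add, map_sum]
    exact Finset.sum_congr rfl fun i _ => u.leibniz _ _
  induction p generalizing f w with
  | zero =>
    rw [List.length_eq_zero_iff.1 (by omega : w.length = 0), hD, Ass.sum_apply]
    refine Finset.sum_eq_zero fun i _ => ?_
    simp [X_nil, hdX i []]
  | succ p ih =>
    rw [hD, Ass.sum_apply]
    refine Finset.sum_eq_zero fun i _ => ?_
    have hsh : ∀ v : List (Fin n), v.length < p → Ass.lshift i f v = 0 := fun v hv =>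
      hf _ (by simp only [List.length_cons]; omega)
    rw [Ass.add_apply, mul_apply_eq_zero (hdX i) hsh w (by omega),
      mul_apply_eq_zero (hX i) (ih _ hsh) w (by omega), zero_add]

theorem pow_toEnd_apply_eq_zero (u : TDer k n) (f : Ass k n) (r : ℕ) (w : List (Fin n))
    (hw : w.length < r) : (u.toEnd ^ r) f w = 0 := by
  induction r generalizing w with
  | zero => omega
  | succ r ih =>
    rw [pow_succ', Module.End.mul_apply]
    exact u.toEnd_apply_eq_zero _ r ih w hw

/-- The automorphism `exp(u) = ∑ u ^ r / r!`. -/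
def exp (u : TDer k n) : Module.End k (Ass k n) :=
  opSeries (fun r => (r.factorial : k)⁻¹) u.toEnd

/-- The series `∑ i, x_i (∂_i a_i)`, whose trace is the divergence. -/
def divRep (u : TDer k n) : Ass k n := ∑ i, X i * partialR i (u.comp i)

/-- The divergence `div(u) = ∑ i, Tr (x_i (∂_i a_i))`. -/
def div (u : TDer k n) : tr k n := Tr u.divRep

/-- The group cocycle `j` integrating `div`, at `exp(u)`:
`j(exp(u)) = ((e ^ u - 1) / u) · div(u) = ∑ u ^ r · div(u) / (r + 1)!`.
The action on `tr_n` is the one induced by the action on `Ass_n`. -/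
def j (u : TDer k n) : tr k n :=
  Tr (opSeries (fun r => ((r + 1).factorial : k)⁻¹) u.toEnd u.divRep)

end TDer

variable (k)

/-- The Lie algebra `sder_2` of special derivations: `u(x + y) = 0`. -/
def sder2 : Set (TDer k 2) := {u | u.toEnd (X 0 + X 1) = 0}

/-- `hkv_2`, the special derivations whose divergence is in the kernel of `δ`. -/
def hkv2 : Set (TDer k 2) := {u | u ∈ sder2 k ∧ u.div ∈ LinearMap.ker (delta k)}

/-- `HKV_2 = exp(hkv_2)`, as a set of automorphisms (the product is composition). -/
def HKV2 : Set (Module.End k (Ass k 2)) := TDer.exp '' hkv2 k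

/-- The set of solutions `F = exp(u)`, with `u` a tangential derivation, of the generalized
Kashiwara–Vergne problem: `F(x + y) = ch(x, y)` and `j(F) ∈ im(δ̃)`. -/
def SolHKV : Set (Module.End k (Ass k 2)) :=
  {F | ∃ u : TDer k 2, F = u.exp ∧ F (X 0 + X 1) = ch k ∧ u.j ∈ LinearMap.range (deltaTilde k)}

end Derivations

end KashiwaraVergne

end

/-!
Sending `1` to a representative `d` of `div u` makes a tangential derivation `u` act on
`Ass_n = k ⊕ Ass_n⁺` by an affine operator. Since `div` is a cocycle, the bracket of two such
operators is again one, so by the Baker–Campbell–Hausdorff theorem a product of their exponentials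
is the exponential of a third. Evaluated at `1`, this is the cocycle identity
`j(FG) = j(F) + F · j(G)`, which makes `TAut_n` a group at the same time.

Comparing coefficients of cyclic words shows that the kernel of `δ` consists of the series
`f(y) - f(x + y) + f(x)`. A tangential automorphism acts on series in one of the generators, up to
trace, as the identity. Hence one which fixes `x + y` acts trivially on `ker δ`, so that `j(exp u)`
equals `div u` as soon as one of them is in `ker δ`; and one which sends `x + y` to `ch(x, y)` maps
`f(y) - f(x + y) + f(x)` to `δ̃ f`. With the cocycle identity, these facts show that `FG` is a
solution if `F` is one and `G` is in `HKV_2`, and that `F⁻¹G` is in `HKV_2` if `F` and `G` are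
solutions.
-/

noncomputable section

namespace KashiwaraVergne

/-! ### Complete filtrations -/

open Finset.HasAntidiagonal (antidiagonal mem_antidiagonal)
open scoped PowerSeries

/-- A complete and separated decreasing filtration of a `k`-module by submodules. Completeness is
encoded by a linear choice `lsum` of the sums of the series `∑ a_r` with `a_r` in the `r`-th step;
the value of `lsum` on other sequences is irrelevant. -/
class CompleteFiltration (k M : Type*) [ringInst : CommRing k] [groupInst : AddCommGroup M]
    [moduleInst : Module k M] where
  fil (k) [ringInst] [groupInst] [moduleInst] : ℕ → Submodule k M
  antitone_fil : Antitone fil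
  eq_zero_of_mem_fil : ∀ {a : M}, (∀ N, a ∈ fil N) → a = 0
  lsum (k) [ringInst] [groupInst] [moduleInst] : (ℕ → M) →ₗ[k] M
  lsum_sub_sum_mem : ∀ {a : ℕ → M}, (∀ r, a r ∈ fil r) →
    ∀ N, lsum a - ∑ r ∈ Finset.range N, a r ∈ fil N

open CompleteFiltration

attribute [local instance] LieRing.ofAssociativeRing

/-- Compatibility of a complete filtration of a `k`-algebra with the multiplication. -/
class IsFilteredAlgebra (k A : Type*) [CommRing k] [Ring A] [Algebra k A]
    [CompleteFiltration k A] : Prop where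
  one_mem_fil : (1 : A) ∈ fil k 0
  mul_mem_fil : ∀ {m n : ℕ} {a b : A}, a ∈ fil k m → b ∈ fil k n → a * b ∈ fil k (m + n)

open IsFilteredAlgebra

section Module

variable {k M M' : Type*} [CommRing k] [AddCommGroup M] [Module k M] [CompleteFiltration k M]
  [AddCommGroup M'] [Module k M'] [CompleteFiltration k M']

theorem fil_le {a : M} {m n : ℕ} (h : m ≤ n) (ha : a ∈ fil k n) : a ∈ fil k m :=
  antitone_fil h ha

variable (k) in
theorem eq_of_sub_mem_fil {a b : M} (h : ∀ N, a - b ∈ fil k N) : a = b :=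
  sub_eq_zero.1 (eq_zero_of_mem_fil h)

theorem lsum_sub (a b : ℕ → M) : (lsum k fun r => a r - b r) = lsum k a - lsum k b :=
  map_sub (lsum k) a b

theorem lsum_add (a b : ℕ → M) : (lsum k fun r => a r + b r) = lsum k a + lsum k b :=
  map_add (lsum k) a b

theorem eq_lsum {a : ℕ → M} (ha : ∀ r, a r ∈ fil k r) {s : M}
    (hs : ∀ N, s - ∑ r ∈ Finset.range N, a r ∈ fil k N) : s = lsum k a :=
  eq_of_sub_mem_fil k fun N => by simpa using sub_mem (hs N) (lsum_sub_sum_mem ha N)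

theorem lsum_sub_sum_mem_of_le {a : ℕ → M} (ha : ∀ r, a r ∈ fil k r) {N p : ℕ}
    (h : ∀ r, N ≤ r → a r ∈ fil k p) : lsum k a - ∑ r ∈ Finset.range N, a r ∈ fil k p := by
  have htail : ∑ r ∈ Finset.Ico N (max N p), a r ∈ fil k p :=
    sum_mem fun r hr => h r (Finset.mem_Ico.1 hr).1
  have hrest := fil_le (le_max_right N p) (lsum_sub_sum_mem ha (max N p))
  rw [← Finset.sum_range_add_sum_Ico _ (le_max_left N p)] at hrest
  convert add_mem hrest htail using 1
  abel

theorem lsum_mem_fil {a : ℕ → M} (ha : ∀ r, a r ∈ fil k r) {p : ℕ} (h : ∀ r, a r ∈ fil k p) :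
    lsum k a ∈ fil k p := by
  simpa using lsum_sub_sum_mem_of_le ha (N := 0) fun r _ => h r

theorem lsum_eq_single {a : ℕ → M} (ha : ∀ r, a r ∈ fil k r) (m : ℕ) (h : ∀ r, r ≠ m → a r = 0) :
    lsum k a = a m :=
  (eq_lsum ha fun N => by
    by_cases hN : m < N
    · rw [Finset.sum_eq_single m (fun r _ hr => h r hr) (by simp [hN]), sub_self]
      exact zero_mem _
    · rw [Finset.sum_eq_zero fun r hr => h r (by rintro rfl; exact hN (Finset.mem_range.1 hr)),
        sub_zero]
      exact fil_le (not_lt.1 hN) (ha m)).symm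

theorem lsum_succ {a : ℕ → M} (ha : ∀ r, a r ∈ fil k r) :
    lsum k a = a 0 + lsum k fun r => a (r + 1) := by
  rw [← sub_eq_iff_eq_add']
  refine eq_lsum (fun r => fil_le r.le_succ (ha (r + 1))) fun N => ?_
  have h := lsum_sub_sum_mem ha (N + 1)
  rw [Finset.sum_range_succ', add_comm (∑ _ ∈ _, _), ← sub_sub] at h
  exact fil_le N.le_succ h

variable (k) in
/-- Submodules which contain the sums of the series with terms in them. -/
def IsSumClosed (S : Submodule k M) : Prop :=
  ∀ ⦃a : ℕ → M⦄, (∀ r, a r ∈ fil k r) → (∀ r, a r ∈ S) → lsum k a ∈ S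

theorem map_lsum_of_mem (φ : M →ₗ[k] M') {S : Submodule k M} (hS : IsSumClosed k S)
    (hφ : ∀ N, ∀ a ∈ S, a ∈ fil k N → φ a ∈ fil k N) {a : ℕ → M} (ha : ∀ r, a r ∈ fil k r)
    (haS : ∀ r, a r ∈ S) : φ (lsum k a) = lsum k fun r => φ (a r) :=
  eq_lsum (fun r => hφ r _ (haS r) (ha r)) fun N => by
    rw [← map_sum, ← map_sub]
    exact hφ N _ (sub_mem (hS ha haS) (sum_mem fun r _ => haS r)) (lsum_sub_sum_mem ha N)

theorem map_lsum (φ : M →ₗ[k] M') (hφ : ∀ N, ∀ a ∈ fil k N, φ a ∈ fil k N) {a : ℕ → M}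
    (ha : ∀ r, a r ∈ fil k r) : φ (lsum k a) = lsum k fun r => φ (a r) :=
  map_lsum_of_mem φ (S := ⊤) (fun _ _ _ => trivial) (fun N a _ => hφ N a) ha fun _ => trivial

theorem isSumClosed_fil (p : ℕ) : IsSumClosed k (fil k p : Submodule k M) :=
  fun _ ha hp => lsum_mem_fil ha hp

theorem IsSumClosed.inf {S T : Submodule k M} (hS : IsSumClosed k S) (hT : IsSumClosed k T) :
    IsSumClosed k (S ⊓ T) :=
  fun _ ha h => ⟨hS ha fun r => (h r).1, hT ha fun r => (h r).2⟩

theorem exists_fixedPoint_of_contracting {S : Submodule k M} (hS : IsSumClosed k S)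
    (hS0 : S ≤ fil k 0) {Φ : M → M} (hΦS : ∀ a ∈ S, Φ a ∈ S)
    (hΦ : ∀ N, ∀ a ∈ S, ∀ b ∈ S, a - b ∈ fil k N → Φ a - Φ b ∈ fil k (N + 1)) :
    ∃ a ∈ S, Φ a = a := by
  set x : ℕ → M := fun N => Φ^[N] 0
  have hx_succ : ∀ N, x (N + 1) = Φ (x N) := fun N => Function.iterate_succ_apply' Φ N 0
  have hxS : ∀ N, x N ∈ S := fun N => by
    induction N with
    | zero => exact zero_mem S
    | succ N ih => exact hx_succ N ▸ hΦS _ ih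
  have hd : ∀ N, x (N + 1) - x N ∈ fil k N := fun N => by
    induction N with
    | zero => exact hS0 (sub_mem (hxS 1) (hxS 0))
    | succ N ih => simpa only [hx_succ] using hΦ N _ (hxS (N + 1)) _ (hxS N) ih
  set a := lsum k fun N => x (N + 1) - x N
  have haS : a ∈ S := hS hd fun N => sub_mem (hxS (N + 1)) (hxS N)
  have ha : ∀ N, a - x N ∈ fil k N := fun N => by
    simpa only [Finset.sum_range_sub x, x, Function.iterate_zero_apply, sub_zero] using
      lsum_sub_sum_mem hd N
  refine ⟨a, haS, eq_of_sub_mem_fil k fun N => fil_le N.le_succ ?_⟩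
  have h := sub_mem (hΦ N _ haS _ (hxS N) (ha N)) (ha (N + 1))
  rwa [hx_succ, sub_sub_sub_cancel_right] at h

end Module

section Algebra

variable {k A : Type*} [CommRing k] [Ring A] [Algebra k A] [CompleteFiltration k A]
  [IsFilteredAlgebra k A]

theorem sum_antidiagonal_mem_fil {a b : ℕ → A} (ha : ∀ r, a r ∈ fil k r)
    (hb : ∀ r, b r ∈ fil k r) (r : ℕ) : ∑ p ∈ antidiagonal r, a p.1 * b p.2 ∈ fil k r :=
  sum_mem fun p hp => mem_antidiagonal.1 hp ▸ mul_mem_fil (ha p.1) (hb p.2)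

theorem sum_mul_sum_sub_mem_fil {a b : ℕ → A} (ha : ∀ r, a r ∈ fil k r)
    (hb : ∀ r, b r ∈ fil k r) (N : ℕ) :
    (∑ r ∈ Finset.range N, a r) * (∑ r ∈ Finset.range N, b r) -
      ∑ r ∈ Finset.range N, ∑ p ∈ antidiagonal r, a p.1 * b p.2 ∈ fil k N := by
  have hdiag : ∑ r ∈ Finset.range N, ∑ p ∈ antidiagonal r, a p.1 * b p.2 =
      ∑ i ∈ Finset.range N, ∑ j ∈ Finset.range (N - i), a i * b j := by
    rw [← Finset.sum_range_diag_flip N fun i j => a i * b j]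
    exact Finset.sum_congr rfl fun r _ =>
      Finset.Nat.sum_antidiagonal_eq_sum_range_succ (fun i j => a i * b j) r
  rw [hdiag, Finset.sum_mul_sum, ← Finset.sum_sub_distrib]
  refine sum_mem fun i hi => ?_
  rw [← Finset.sum_sdiff (Finset.range_subset_range.2 (Nat.sub_le N i)), add_sub_cancel_right]
  refine sum_mem fun j hj => fil_le ?_ (mul_mem_fil (ha i) (hb j))
  simp only [Finset.mem_sdiff, Finset.mem_range] at hj hi
  omega

theorem lsum_mul {a : ℕ → A} (ha : ∀ r, a r ∈ fil k r) {b : A} (hb : b ∈ fil k 0) :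
    lsum k a * b = lsum k fun r => a r * b :=
  map_lsum (LinearMap.mulRight k b) (fun _ _ hc => mul_mem_fil hc hb) ha

theorem mul_lsum {a : ℕ → A} (ha : ∀ r, a r ∈ fil k r) {b : A} (hb : b ∈ fil k 0) :
    b * lsum k a = lsum k fun r => b * a r :=
  map_lsum (LinearMap.mulLeft k b) (fun N _ hc => zero_add N ▸ mul_mem_fil hb hc) ha

theorem lsum_mul_lsum {a b : ℕ → A} (ha : ∀ r, a r ∈ fil k r) (hb : ∀ r, b r ∈ fil k r) :
    lsum k a * lsum k b = lsum k fun r => ∑ p ∈ antidiagonal r, a p.1 * b p.2 := by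
  refine eq_lsum (sum_antidiagonal_mem_fil ha hb) fun N => ?_
  have hsum : ∑ r ∈ Finset.range N, a r ∈ fil k 0 :=
    sum_mem fun r _ => fil_le r.zero_le (ha r)
  have hb0 := lsum_mem_fil hb fun r => fil_le r.zero_le (hb r)
  have h₁ := mul_mem_fil (lsum_sub_sum_mem ha N) hb0
  have h₂ := mul_mem_fil hsum (lsum_sub_sum_mem hb N)
  rw [add_zero] at h₁
  rw [zero_add] at h₂
  convert add_mem (add_mem h₁ h₂) (sum_mul_sum_sub_mem_fil ha hb N) using 1
  noncomm_ring

theorem pow_mem_fil {a : A} (ha : a ∈ fil k 1) (r : ℕ) : a ^ r ∈ fil k r := by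
  induction r with
  | zero => simpa using one_mem_fil
  | succ r ih => rw [pow_succ]; exact mul_mem_fil ih ha

variable (k) in
theorem lie_mem_fil {m n : ℕ} {a b : A} (ha : a ∈ fil k m) (hb : b ∈ fil k n) :
    ⁅a, b⁆ ∈ fil k (m + n) :=
  sub_mem (mul_mem_fil ha hb) (add_comm m n ▸ mul_mem_fil hb ha)

theorem ad_pow_mem_fil {a b : A} {n : ℕ} (ha : a ∈ fil k 1) (hb : b ∈ fil k n) (r : ℕ) :
    (LieAlgebra.ad k A a ^ r) b ∈ fil k (n + r) := by
  induction r with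
  | zero => simpa using hb
  | succ r ih =>
    rw [pow_succ', Module.End.mul_apply, LieAlgebra.ad_apply, add_comm r, ← add_assoc,
      add_comm n, add_assoc]
    exact lie_mem_fil k ha ih

end Algebra

section SeriesEval

variable {k A : Type*} [CommRing k] [Ring A] [Algebra k A] [CompleteFiltration k A]

/-- The value `∑ c_r a ^ r` of the power series `P = ∑ c_r X ^ r` at `a`, for `a` in the first
step of a filtration. -/
def seriesEval (a : A) : k⟦X⟧ →ₗ[k] A :=
  lsum k ∘ₗ LinearMap.pi fun r => (PowerSeries.coeff r).smulRight (a ^ r)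

theorem seriesEval_apply (a : A) (P : k⟦X⟧) :
    seriesEval a P = lsum k fun r => PowerSeries.coeff r P • a ^ r := rfl

theorem seriesEval_neg (a : A) (P : k⟦X⟧) :
    seriesEval (-a) P = seriesEval a (PowerSeries.evalNegHom P) := by
  simp only [seriesEval_apply, PowerSeries.evalNegHom, PowerSeries.coeff_rescale]
  congr 1 with r
  rw [neg_pow, mul_comm, mul_smul]
  rcases Nat.even_or_odd r with h | h <;> simp [h.neg_one_pow]

variable [IsFilteredAlgebra k A]

theorem coeff_smul_pow_mem_fil {a : A} (ha : a ∈ fil k 1) (P : k⟦X⟧) (r : ℕ) :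
    PowerSeries.coeff r P • a ^ r ∈ fil k r :=
  Submodule.smul_mem _ _ (pow_mem_fil ha r)

theorem seriesEval_mul {a : A} (ha : a ∈ fil k 1) (P Q : k⟦X⟧) :
    seriesEval a (P * Q) = seriesEval a P * seriesEval a Q := by
  simp only [seriesEval_apply]
  rw [lsum_mul_lsum (coeff_smul_pow_mem_fil ha P) (coeff_smul_pow_mem_fil ha Q)]
  congr 1 with r
  rw [PowerSeries.coeff_mul, Finset.sum_smul]
  refine Finset.sum_congr rfl fun p hp => ?_
  rw [← mem_antidiagonal.1 hp, pow_add, smul_mul_smul_comm]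

theorem seriesEval_C {a : A} (ha : a ∈ fil k 1) (c : k) :
    seriesEval a (PowerSeries.C c) = c • 1 := by
  rw [seriesEval_apply, lsum_eq_single (coeff_smul_pow_mem_fil ha _) 0 fun r hr => by
    simp [PowerSeries.coeff_C, hr]]
  simp

theorem seriesEval_one {a : A} (ha : a ∈ fil k 1) : seriesEval a (1 : k⟦X⟧) = 1 := by
  simpa using seriesEval_C ha 1

theorem seriesEval_X {a : A} (ha : a ∈ fil k 1) :
    seriesEval a (PowerSeries.X : k⟦X⟧) = a := by
  rw [seriesEval_apply, lsum_eq_single (coeff_smul_pow_mem_fil ha _) 1 fun r hr => by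
    simp [PowerSeries.coeff_X, hr]]
  simp

end SeriesEval

section AssFiltration

variable {k : Type*} [Field k] {n : ℕ}

instance : CompleteFiltration k (Ass k n) where
  fil N :=
    { carrier := {f | ∀ w, w.length < N → f w = 0}
      add_mem' := fun hf hg w hw => by rw [Ass.add_apply, hf w hw, hg w hw, add_zero]
      zero_mem' := fun _ _ => rfl
      smul_mem' := fun c f hf w hw => by rw [Ass.smul_apply, hf w hw, mul_zero] }
  antitone_fil _ _ h _ hf w hw := hf w (hw.trans_le h)
  eq_zero_of_mem_fil h := Ass.ext (funext fun w => h (w.length + 1) w w.length.lt_succ_self)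
  lsum :=
    { toFun := fun a => ⟨fun w => ∑ r ∈ Finset.range (w.length + 1), a r w⟩
      map_add' := fun a b => by ext w; simp [Finset.sum_add_distrib]
      map_smul' := fun c a => by ext w; simp [Finset.mul_sum] }
  lsum_sub_sum_mem {a} ha N w hw := by
    rw [Ass.sub_apply, Ass.sum_apply, sub_eq_zero]
    refine Finset.sum_subset (Finset.range_subset_range.2 hw) fun r _ hr => ha r w ?_
    simpa using hr

instance : IsFilteredAlgebra k (Ass k n) where
  one_mem_fil _ hw := absurd hw (Nat.not_lt_zero _)
  mul_mem_fil ha hb w hw := mul_apply_eq_zero ha hb w hw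

theorem Ass.mem_fil_zero (f : Ass k n) : f ∈ fil k 0 := fun _ hw => absurd hw (Nat.not_lt_zero _)

theorem Ass.mem_fil_one {f : Ass k n} : f ∈ fil k 1 ↔ f [] = 0 :=
  ⟨fun h => h [] one_pos, fun h w hw => by
    rw [List.length_eq_zero_iff.1 (Nat.lt_one_iff.1 hw), h]⟩

theorem Ass.lsum_apply (a : ℕ → Ass k n) (w : List (Fin n)) :
    lsum k a w = ∑ r ∈ Finset.range (w.length + 1), a r w := rfl

instance : CompleteFiltration k (Module.End k (Ass k n)) where
  fil N :=
    { carrier := {T | ∀ p, ∀ f ∈ fil k p, T f ∈ fil k (p + N)}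
      add_mem' := fun hS hT p f hf => add_mem (hS p f hf) (hT p f hf)
      zero_mem' := fun _ _ _ => zero_mem _
      smul_mem' := fun c _ hT p f hf => Submodule.smul_mem _ c (hT p f hf) }
  antitone_fil _ _ h _ hT p f hf := fil_le (Nat.add_le_add_left h p) (hT p f hf)
  eq_zero_of_mem_fil h := LinearMap.ext fun f => eq_zero_of_mem_fil (k := k) fun N => by
    simpa using h N 0 f f.mem_fil_zero
  lsum :=
    { toFun := fun a => lsum k ∘ₗ LinearMap.pi a
      map_add' := fun a b => LinearMap.ext fun f => map_add (lsum k) (fun r => a r f) fun r => b r f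
      map_smul' := fun c a => LinearMap.ext fun f => map_smul (lsum k) c fun r => a r f }
  lsum_sub_sum_mem {a} ha N p f hf := by
    rw [LinearMap.sub_apply, LinearMap.sum_apply]
    exact lsum_sub_sum_mem_of_le (fun r => fil_le (Nat.le_add_left r p) (ha r p f hf))
      fun r hr => fil_le (Nat.add_le_add_left hr p) (ha r p f hf)

instance : IsFilteredAlgebra k (Module.End k (Ass k n)) where
  one_mem_fil _ _ hf := hf
  mul_mem_fil {m n _ _} hS hT p f hf := by
    rw [add_comm m n, ← add_assoc]
    exact hS _ _ (hT p f hf)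

theorem lsum_end_apply (a : ℕ → Module.End k (Ass k n)) (f : Ass k n) :
    lsum k a f = lsum k fun r => a r f := rfl

theorem end_apply_mem_fil {T : Module.End k (Ass k n)} {N : ℕ} (hT : T ∈ fil k N) (f : Ass k n) :
    T f ∈ fil k N := by simpa using hT 0 f f.mem_fil_zero

theorem mulLeft_mem_fil {f : Ass k n} {N : ℕ} (hf : f ∈ fil k N) :
    LinearMap.mulLeft k f ∈ fil k N :=
  fun p _ hg => add_comm p N ▸ mul_mem_fil hf hg

theorem opSeries_eq_seriesEval (P : k⟦X⟧) (D : Module.End k (Ass k n)) :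
    opSeries (fun r => PowerSeries.coeff r P) D = seriesEval D P := rfl

end AssFiltration

section PowerSeriesFiltration

variable {k R : Type*} [CommRing k] [Ring R] [Algebra k R]

instance : CompleteFiltration k R⟦X⟧ where
  fil N :=
    { carrier := {P | ∀ m < N, PowerSeries.coeff m P = 0}
      add_mem' := fun hP hQ m hm => by rw [map_add, hP m hm, hQ m hm, add_zero]
      zero_mem' := fun _ _ => map_zero _
      smul_mem' := fun c P hP m hm => by rw [PowerSeries.coeff_smul, hP m hm, smul_zero] }
  antitone_fil _ _ h _ hP m hm := hP m (hm.trans_le h)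
  eq_zero_of_mem_fil h := PowerSeries.ext fun m => h (m + 1) m m.lt_succ_self
  lsum :=
    { toFun := fun a => PowerSeries.mk fun m =>
        ∑ r ∈ Finset.range (m + 1), PowerSeries.coeff m (a r)
      map_add' := fun a b => by ext m; simp [Finset.sum_add_distrib]
      map_smul' := fun c a => by ext m; simp [Finset.smul_sum] }
  lsum_sub_sum_mem {a} ha N m hm := by
    rw [map_sub, map_sum, sub_eq_zero]
    refine (PowerSeries.coeff_mk m fun m =>
      ∑ r ∈ Finset.range (m + 1), PowerSeries.coeff m (a r)).trans ?_
    refine Finset.sum_subset (Finset.range_subset_range.2 hm) fun r _ hr => ha r m ?_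
    simpa using hr

instance : IsFilteredAlgebra k R⟦X⟧ where
  one_mem_fil _ hm := absurd hm (Nat.not_lt_zero _)
  mul_mem_fil {m n a b} ha hb r hr := by
    rw [PowerSeries.coeff_mul]
    refine Finset.sum_eq_zero fun p hp => ?_
    have hpr := mem_antidiagonal.1 hp
    rcases lt_or_ge p.1 m with h | h
    · rw [ha _ h, zero_mul]
    · rw [hb _ (by omega), mul_zero]

variable (k) in
theorem coeff_lsum (a : ℕ → R⟦X⟧) (m : ℕ) : PowerSeries.coeff m (lsum k a) =
    ∑ r ∈ Finset.range (m + 1), PowerSeries.coeff m (a r) :=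
  PowerSeries.coeff_mk m fun m => ∑ r ∈ Finset.range (m + 1), PowerSeries.coeff m (a r)

end PowerSeriesFiltration

section Exponential

variable {k : Type*} [Field k]

/-- The exponential `∑ a ^ r / r!` of an element of the first step of a filtration. -/
def filExp (k : Type*) {A : Type*} [Field k] [CharZero k] [Ring A] [Algebra k A]
    [CompleteFiltration k A] (a : A) : A :=
  seriesEval a (PowerSeries.exp k)

theorem coeff_exp [CharZero k] (r : ℕ) :
    PowerSeries.coeff r (PowerSeries.exp k) = (r.factorial : k)⁻¹ := by
  simp [PowerSeries.coeff_exp]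

theorem filExp_eq_lsum [CharZero k] {A : Type*} [Ring A] [Algebra k A] [CompleteFiltration k A]
    (a : A) : filExp k a = lsum k fun r => (r.factorial : k)⁻¹ • a ^ r := by
  simp only [filExp, seriesEval_apply, coeff_exp]

theorem divPow_add [CharZero k] {A : Type*} [Ring A] [Algebra k A] {a b : A}
    (h : Commute a b) (n : ℕ) : (n.factorial : k)⁻¹ • (a + b) ^ n = ∑ p ∈ antidiagonal n,
      ((p.1.factorial : k)⁻¹ • a ^ p.1) * ((p.2.factorial : k)⁻¹ • b ^ p.2) := by
  rw [h.add_pow', Finset.smul_sum]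
  refine Finset.sum_congr rfl fun p hp => ?_
  obtain rfl := mem_antidiagonal.1 hp
  have hne : ∀ m : ℕ, (m.factorial : k) ≠ 0 := fun m => Nat.cast_ne_zero.2 m.factorial_ne_zero
  rw [smul_mul_smul_comm, ← Nat.cast_smul_eq_nsmul k, smul_smul]
  congr 1
  field_simp [hne]
  exact_mod_cast Nat.choose_symm_add ▸ Nat.add_choose_mul_factorial_mul_factorial p.1 p.2

section Ad

variable {A : Type*} [Ring A] [Algebra k A]

theorem divPow_mul [CharZero k] (a b : A) (n : ℕ) :
    ((n.factorial : k)⁻¹ • a ^ n) * b = ∑ p ∈ antidiagonal n,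
      ((p.1.factorial : k)⁻¹ • (LieAlgebra.ad k A a ^ p.1) b) *
        ((p.2.factorial : k)⁻¹ • a ^ p.2) := by
  have hL : LinearMap.mulLeft k a = LinearMap.mulRight k a + LieAlgebra.ad k A a := by
    ext b; simp [LieRing.of_associative_ring_bracket]
  have hcomm : Commute (LinearMap.mulRight k a) (LieAlgebra.ad k A a) := by
    ext b; simp [LieRing.of_associative_ring_bracket, sub_mul, mul_assoc]
  have h := LinearMap.congr_fun (divPow_add (k := k) hcomm n) b
  rw [← hL, LinearMap.smul_apply, LinearMap.pow_mulLeft, LinearMap.mulLeft_apply,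
    ← smul_mul_assoc] at h
  rw [h, LinearMap.sum_apply, ← Finset.Nat.sum_antidiagonal_swap]
  refine Finset.sum_congr rfl fun p _ => ?_
  simp [LinearMap.pow_mulRight, smul_smul, mul_comm]

variable {D : Module.End k A} (hD : ∀ a b, D (a * b) = D a * b + a * D b)
include hD

theorem lie_mulLeft_of_leibniz (a : A) :
    ⁅D, LinearMap.mulLeft k a⁆ = LinearMap.mulLeft k (D a) := by
  ext b; simp [LieRing.of_associative_ring_bracket, hD]

theorem ad_mulLeft_pow_of_leibniz (a : A) (r : ℕ) :
    (LieAlgebra.ad k (Module.End k A) (LinearMap.mulLeft k a) ^ (r + 1)) D =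
      -LinearMap.mulLeft k ((LieAlgebra.ad k A a ^ r) (D a)) := by
  induction r with
  | zero => simp [← lie_mulLeft_of_leibniz hD]
  | succ r ih =>
    rw [pow_succ', Module.End.mul_apply, ih, pow_succ' _ r, Module.End.mul_apply]
    ext b
    simp [LieRing.of_associative_ring_bracket, sub_mul, mul_assoc, neg_add_eq_sub]

/-- The logarithmic derivative of the exponential, degree by degree: apply `divPow_mul` to left
multiplication by `a` and `D`, and evaluate at `1`. -/
theorem map_divPow_succ_of_leibniz [CharZero k] (a : A) (n : ℕ) :
    D (((n + 1).factorial : k)⁻¹ • a ^ (n + 1)) = ∑ p ∈ antidiagonal n,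
      (((p.1 + 1).factorial : k)⁻¹ • (LieAlgebra.ad k A a ^ p.1) (D a)) *
        ((p.2.factorial : k)⁻¹ • a ^ p.2) := by
  have hD1 : D 1 = 0 := by simpa using hD 1 1
  have h := LinearMap.congr_fun (divPow_mul (k := k) (LinearMap.mulLeft k a) D (n + 1)) 1
  rw [Finset.Nat.sum_antidiagonal_succ] at h
  simp only [ad_mulLeft_pow_of_leibniz hD, LinearMap.add_apply, LinearMap.sum_apply,
    Module.End.mul_apply, LinearMap.smul_apply, LinearMap.pow_mulLeft, LinearMap.mulLeft_apply,
    LinearMap.neg_apply, hD1, mul_zero, smul_zero, mul_one, pow_zero, Module.End.one_apply,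
    Nat.factorial_zero, Nat.cast_one, inv_one, one_smul, smul_neg, Finset.sum_neg_distrib,
    ← sub_eq_add_neg] at h
  simpa only [smul_mul_assoc] using (sub_eq_zero.1 h.symm)

end Ad

end Exponential

/-! ### The Baker–Campbell–Hausdorff theorem -/

section FilteredExponential

variable {k A : Type*} [Field k] [Ring A] [Algebra k A] [CompleteFiltration k A]

variable (k) in
/-- The action `∑ (ad a) ^ i b / i!` of `exp (ad a)` on `b`. -/
def expAd (a b : A) : A := lsum k fun i => (i.factorial : k)⁻¹ • (LieAlgebra.ad k A a ^ i) b

variable [IsFilteredAlgebra k A]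

theorem divPow_mem_fil {a : A} (ha : a ∈ fil k 1) (r : ℕ) :
    (r.factorial : k)⁻¹ • a ^ r ∈ fil k r :=
  Submodule.smul_mem _ _ (pow_mem_fil ha r)

theorem smul_ad_pow_mem_fil (c : k) {a b : A} {N : ℕ} (ha : a ∈ fil k 1) (hb : b ∈ fil k N)
    (r : ℕ) : c • (LieAlgebra.ad k A a ^ r) b ∈ fil k (N + r) :=
  Submodule.smul_mem _ _ (ad_pow_mem_fil ha hb r)

theorem filExp_mul [CharZero k] {a b : A} (ha : a ∈ fil k 1) (hb : b ∈ fil k 0) :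
    filExp k a * b = expAd k a b * filExp k a := by
  rw [filExp_eq_lsum, expAd, lsum_mul (divPow_mem_fil ha) hb, lsum_mul_lsum
    (fun r => fil_le (Nat.le_add_left r 0) (smul_ad_pow_mem_fil _ ha hb r)) (divPow_mem_fil ha)]
  simp only [divPow_mul]

theorem filExp_sub_one_mem_fil [CharZero k] {a : A} (ha : a ∈ fil k 1) :
    filExp k a - 1 ∈ fil k 1 := by
  simpa [filExp_eq_lsum] using lsum_sub_sum_mem (divPow_mem_fil ha) 1

end FilteredExponential

section GradedSeries

variable {k R : Type*} [Field k] [Ring R] [Algebra k R]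

/-- The operator multiplying the coefficient of `X ^ m` by `c m`. -/
def coeffScale (c : ℕ → k) : R⟦X⟧ →ₗ[k] R⟦X⟧ where
  toFun P := PowerSeries.mk fun m => c m • PowerSeries.coeff m P
  map_add' P Q := by ext; simp
  map_smul' a P := by ext; simp [smul_comm a]

@[simp] theorem coeff_coeffScale (c : ℕ → k) (P : R⟦X⟧) (m : ℕ) :
    PowerSeries.coeff m (coeffScale c P) = c m • PowerSeries.coeff m P :=
  PowerSeries.coeff_mk m fun m => c m • PowerSeries.coeff m P

theorem coeffScale_mem_fil (c : ℕ → k) {P : R⟦X⟧} {N : ℕ} (hP : P ∈ fil k N) :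
    coeffScale c P ∈ fil k N := fun m hm => by
  rw [coeff_coeffScale, hP m hm, smul_zero]

variable (k R) in
/-- The Euler operator `X d/dX`. -/
def euler : R⟦X⟧ →ₗ[k] R⟦X⟧ := coeffScale fun m => (m : k)

variable (k R) in
/-- The inverse of the Euler operator on series without constant term. -/
def eulerInv : R⟦X⟧ →ₗ[k] R⟦X⟧ := coeffScale fun m => (m : k)⁻¹

theorem euler_mem_fil {P : R⟦X⟧} {N : ℕ} (hP : P ∈ fil k N) : euler k R P ∈ fil k N :=
  coeffScale_mem_fil _ hP

theorem euler_mul (P Q : R⟦X⟧) : euler k R (P * Q) = euler k R P * Q + P * euler k R Q := by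
  ext m
  simp only [euler, coeff_coeffScale, PowerSeries.coeff_mul, map_add, Finset.smul_sum,
    ← Finset.sum_add_distrib]
  refine Finset.sum_congr rfl fun p hp => ?_
  rw [← mem_antidiagonal.1 hp, Nat.cast_add, add_smul, smul_mul_assoc, mul_smul_comm]

theorem euler_eulerInv [CharZero k] {P : R⟦X⟧} (hP : P ∈ fil k 1) :
    euler k R (eulerInv k R P) = P := by
  ext m
  rcases eq_or_ne m 0 with rfl | hm
  · rw [hP 0 one_pos, euler, coeff_coeffScale, Nat.cast_zero, zero_smul]
  · rw [euler, eulerInv, coeff_coeffScale, coeff_coeffScale,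
      smul_inv_smul₀ (Nat.cast_ne_zero.2 hm)]

theorem eulerInv_euler [CharZero k] {P : R⟦X⟧} (hP : P ∈ fil k 1) :
    eulerInv k R (euler k R P) = P := by
  ext m
  rcases eq_or_ne m 0 with rfl | hm
  · rw [hP 0 one_pos, eulerInv, coeff_coeffScale, Nat.cast_zero, inv_zero, zero_smul]
  · rw [euler, eulerInv, coeff_coeffScale, coeff_coeffScale,
      inv_smul_smul₀ (Nat.cast_ne_zero.2 hm)]

theorem eq_of_euler_eq_mul [CharZero k] {P Q K : R⟦X⟧} (hK : K ∈ fil k 1)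
    (hP : euler k R P = K * P) (hQ : euler k R Q = K * Q) (h : P - Q ∈ fil k 1) : P = Q := by
  have hPQ : P - Q = eulerInv k R (K * (P - Q)) := by
    rw [mul_sub, ← hP, ← hQ, ← map_sub, eulerInv_euler h]
  refine eq_of_sub_mem_fil k fun N => ?_
  induction N with
  | zero => exact fil_le zero_le_one h
  | succ N ih =>
    rw [hPQ]
    exact coeffScale_mem_fil _ (add_comm 1 N ▸ mul_mem_fil hK ih)

variable (k) in
/-- The logarithmic derivative `∑ (ad W) ^ r (euler W) / (r + 1)!` of `exp W`. -/
def logDerivExp (W : R⟦X⟧) : R⟦X⟧ :=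
  lsum k fun r => ((r + 1).factorial : k)⁻¹ • (LieAlgebra.ad k R⟦X⟧ W ^ r) (euler k R W)

theorem logDerivExp_term_mem_fil {W : R⟦X⟧} (hW : W ∈ fil k 1) (r : ℕ) :
    ((r + 1).factorial : k)⁻¹ • (LieAlgebra.ad k R⟦X⟧ W ^ r) (euler k R W) ∈ fil k (1 + r) :=
  smul_ad_pow_mem_fil _ hW (euler_mem_fil hW) r

theorem logDerivExp_mem_fil {W : R⟦X⟧} (hW : W ∈ fil k 1) : logDerivExp k W ∈ fil k 1 :=
  lsum_mem_fil (fun r => fil_le (Nat.le_add_left r 1) (logDerivExp_term_mem_fil hW r))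
    fun r => fil_le (Nat.le_add_right 1 r) (logDerivExp_term_mem_fil hW r)

theorem euler_filExp [CharZero k] {W : R⟦X⟧} (hW : W ∈ fil k 1) :
    euler k R (filExp k W) = logDerivExp k W * filExp k W := by
  have hterm : ∀ r, ((r + 1).factorial : k)⁻¹ • (LieAlgebra.ad k R⟦X⟧ W ^ r) (euler k R W) ∈
      fil k r := fun r => fil_le (Nat.le_add_left r 1) (logDerivExp_term_mem_fil hW r)
  rw [filExp_eq_lsum, logDerivExp, lsum_mul_lsum hterm (divPow_mem_fil hW),
    map_lsum (euler k R) (fun N P hP => euler_mem_fil hP) (divPow_mem_fil hW),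
    lsum_succ fun r => euler_mem_fil (divPow_mem_fil hW r)]
  simp only [← map_divPow_succ_of_leibniz (D := euler k R) euler_mul]
  suffices h : euler k R (1 : R⟦X⟧) = 0 by simp [h]
  simpa using euler_mul (k := k) (1 : R⟦X⟧) 1

variable (k) in
theorem ad_pow_sub_ad_pow_mem_fil {A : Type*} [Ring A] [Algebra k A] [CompleteFiltration k A]
    [IsFilteredAlgebra k A] {a a' b b' : A} {N : ℕ} (ha : a ∈ fil k 1) (ha' : a' ∈ fil k 1)
    (hb : b ∈ fil k 1) (hab : a - a' ∈ fil k N) (hbb : b - b' ∈ fil k N) (r : ℕ) :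
    (LieAlgebra.ad k A a ^ r) b - (LieAlgebra.ad k A a' ^ r) b' ∈ fil k (N + r) := by
  induction r with
  | zero => simpa using hbb
  | succ r ih =>
    simp only [pow_succ', Module.End.mul_apply, LieAlgebra.ad_apply]
    have hsplit : ∀ c c' : A, ⁅a, c⁆ - ⁅a', c'⁆ = ⁅a - a', c⁆ + ⁅a', c - c'⁆ := fun c c' => by
      rw [sub_lie, lie_sub]; abel
    rw [hsplit]
    refine add_mem ?_ ?_
    · convert lie_mem_fil k hab (ad_pow_mem_fil ha hb r) using 2; omega
    · convert lie_mem_fil k ha' ih using 2; omega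

theorem logDerivExp_sub_sub_mem_fil {W W' : R⟦X⟧} {N : ℕ} (hW : W ∈ fil k 1)
    (hW' : W' ∈ fil k 1) (h : W - W' ∈ fil k N) :
    logDerivExp k W - logDerivExp k W' - euler k R (W - W') ∈ fil k (N + 1) := by
  have hterm : ∀ r, ((r + 1).factorial : k)⁻¹ • (LieAlgebra.ad k R⟦X⟧ W ^ r) (euler k R W) -
      ((r + 1).factorial : k)⁻¹ • (LieAlgebra.ad k R⟦X⟧ W' ^ r) (euler k R W') ∈
        fil k (N + r) := fun r => by
    rw [← smul_sub]
    refine Submodule.smul_mem _ _ (ad_pow_sub_ad_pow_mem_fil k hW hW' ?_ h ?_ r)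
    · exact euler_mem_fil hW
    · exact map_sub (euler k R) W W' ▸ euler_mem_fil h
  convert lsum_sub_sum_mem_of_le (fun r => fil_le (Nat.le_add_left r N) (hterm r)) (N := 1)
    fun r hr => fil_le (Nat.add_le_add_left hr N) (hterm r) using 1
  simp [logDerivExp, lsum_sub]

/-- The power series whose coefficient of `X ^ r` lies in `L r`. -/
def gradedSeries (L : ℕ → Submodule k R) : Submodule k R⟦X⟧ where
  carrier := {P | ∀ r, PowerSeries.coeff r P ∈ L r}
  add_mem' hP hQ r := by rw [map_add]; exact add_mem (hP r) (hQ r)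
  zero_mem' r := by rw [map_zero]; exact zero_mem _
  smul_mem' c P hP r := by rw [PowerSeries.coeff_smul]; exact Submodule.smul_mem _ c (hP r)

variable {L : ℕ → Submodule k R}

theorem isSumClosed_gradedSeries : IsSumClosed k (gradedSeries L) := fun a _ ha m => by
  rw [coeff_lsum]
  exact sum_mem fun r _ => ha r m

theorem coeffScale_mem_gradedSeries (c : ℕ → k) {P : R⟦X⟧} (hP : P ∈ gradedSeries L) :
    coeffScale c P ∈ gradedSeries L := fun m => by
  rw [coeff_coeffScale]
  exact Submodule.smul_mem _ _ (hP m)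

variable (hL : ∀ m n : ℕ, ∀ a ∈ L m, ∀ b ∈ L n, ⁅a, b⁆ ∈ L (m + n))
include hL

theorem lie_mem_gradedSeries {P Q : R⟦X⟧} (hP : P ∈ gradedSeries L) (hQ : Q ∈ gradedSeries L) :
    ⁅P, Q⁆ ∈ gradedSeries L := fun r => by
  rw [LieRing.of_associative_ring_bracket, map_sub, PowerSeries.coeff_mul, PowerSeries.coeff_mul,
    ← Finset.Nat.sum_antidiagonal_swap (f := fun p => PowerSeries.coeff p.1 Q * _),
    ← Finset.sum_sub_distrib]
  refine sum_mem fun p hp => ?_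
  rw [← mem_antidiagonal.1 hp]
  exact hL p.1 p.2 _ (hP p.1) _ (hQ p.2)

theorem smul_ad_pow_mem_gradedSeries (c : k) {P Q : R⟦X⟧} (hP : P ∈ gradedSeries L)
    (hQ : Q ∈ gradedSeries L) (r : ℕ) :
    c • (LieAlgebra.ad k R⟦X⟧ P ^ r) Q ∈ gradedSeries L := by
  refine Submodule.smul_mem _ _ ?_
  induction r with
  | zero => exact hQ
  | succ r ih =>
    rw [pow_succ', Module.End.mul_apply]
    exact lie_mem_gradedSeries hL hP ih

theorem logDerivExp_mem_gradedSeries {W : R⟦X⟧} (hW : W ∈ gradedSeries L) (hW1 : W ∈ fil k 1) :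
    logDerivExp k W ∈ gradedSeries L :=
  isSumClosed_gradedSeries
    (fun r => fil_le (Nat.le_add_left r 1) (logDerivExp_term_mem_fil hW1 r))
    (fun r => smul_ad_pow_mem_gradedSeries hL _ hW (coeffScale_mem_gradedSeries _ hW) r)

/-- Modulo higher order, `logDerivExp` is the invertible operator `euler`, so that the equation can
be solved by successive approximations. -/
theorem exists_logDerivExp_eq [CharZero k] {K : R⟦X⟧} (hK : K ∈ gradedSeries L)
    (hK1 : K ∈ fil k 1) : ∃ W ∈ gradedSeries L ⊓ fil k 1, logDerivExp k W = K := by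
  obtain ⟨W, hW, hfix⟩ := exists_fixedPoint_of_contracting (k := k)
    (isSumClosed_gradedSeries.inf (isSumClosed_fil 1)) (fun W hW => fil_le zero_le_one hW.2)
    (Φ := fun W => W - eulerInv k R (logDerivExp k W - K))
    (fun W hW => ⟨sub_mem hW.1 (coeffScale_mem_gradedSeries _
        (sub_mem (logDerivExp_mem_gradedSeries hL hW.1 hW.2) hK)),
      sub_mem hW.2 (coeffScale_mem_fil _ (sub_mem (logDerivExp_mem_fil hW.2) hK1))⟩)
    fun N W hW W' hW' h => by
      have hstep : W - eulerInv k R (logDerivExp k W - K) -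
          (W' - eulerInv k R (logDerivExp k W' - K)) =
            -eulerInv k R (logDerivExp k W - logDerivExp k W' - euler k R (W - W')) := by
        simp only [map_sub, eulerInv_euler hW.2, eulerInv_euler hW'.2]
        abel
      rw [hstep]
      exact neg_mem (coeffScale_mem_fil _ (logDerivExp_sub_sub_mem_fil hW.2 hW'.2 h))
  refine ⟨W, hW, sub_eq_zero.1 ?_⟩
  rw [← euler_eulerInv (sub_mem (logDerivExp_mem_fil hW.2) hK1), sub_eq_self.1 hfix, map_zero]

theorem exists_filExp_eq_mul_of_mem_gradedSeries [CharZero k] {U V : R⟦X⟧}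
    (hU : U ∈ gradedSeries L ⊓ fil k 1) (hV : V ∈ gradedSeries L ⊓ fil k 1) :
    ∃ W ∈ gradedSeries L ⊓ fil k 1, filExp k W = filExp k U * filExp k V := by
  have hLV := logDerivExp_mem_fil hV.2
  have hexpAd : expAd k U (logDerivExp k V) ∈ gradedSeries L ⊓ fil k 1 :=
    (isSumClosed_gradedSeries.inf (isSumClosed_fil 1))
      (fun r => fil_le (Nat.le_add_left r 1) (smul_ad_pow_mem_fil _ hU.2 hLV r))
      fun r => ⟨smul_ad_pow_mem_gradedSeries hL _ hU.1
        (logDerivExp_mem_gradedSeries hL hV.1 hV.2) r,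
        fil_le (Nat.le_add_right 1 r) (smul_ad_pow_mem_fil _ hU.2 hLV r)⟩
  obtain ⟨W, hW, hWlog⟩ := exists_logDerivExp_eq hL
    (add_mem (logDerivExp_mem_gradedSeries hL hU.1 hU.2) hexpAd.1)
    (add_mem (logDerivExp_mem_fil hU.2) hexpAd.2)
  refine ⟨W, hW, eq_of_euler_eq_mul (hWlog ▸ logDerivExp_mem_fil hW.2) ?_ ?_ ?_⟩
  · rw [euler_filExp hW.2, hWlog]
  · rw [euler_mul, euler_filExp hU.2, euler_filExp hV.2, add_mul, ← mul_assoc (filExp k U),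
      filExp_mul hU.2 (fil_le zero_le_one hLV), mul_assoc, mul_assoc]
  · have h₁ := filExp_sub_one_mem_fil hW.2
    have hU' := filExp_sub_one_mem_fil hU.2
    have hV' := filExp_sub_one_mem_fil hV.2
    have h₂ := fil_le (k := k) (Nat.le_add_right 1 1) (mul_mem_fil hU' hV')
    convert sub_mem h₁ (add_mem h₂ (add_mem hU' hV')) using 1
    noncomm_ring

end GradedSeries

section EvalOne

variable {k A : Type*} [Field k] [Ring A] [Algebra k A] [CompleteFiltration k A]

variable (k A) in
/-- The value at `X = 1` of the power series over `A` whose `r`-th coefficient lies in the `r`-th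
step of the filtration. -/
def evalOne : A⟦X⟧ →ₗ[k] A where
  toFun P := lsum k fun r => PowerSeries.coeff r P
  map_add' P Q := by
    simp only [map_add]; exact map_add (lsum k) (fun r => PowerSeries.coeff r P) _
  map_smul' c P := by
    simp only [PowerSeries.coeff_smul]
    exact map_smul (lsum k) c fun r => PowerSeries.coeff r P

theorem evalOne_apply (P : A⟦X⟧) : evalOne k A P = lsum k fun r => PowerSeries.coeff r P := rfl

theorem evalOne_monomial {a : A} {m : ℕ} (ha : a ∈ fil k m) :
    evalOne k A (PowerSeries.monomial m a) = a := by
  have hzero : ∀ r, r ≠ m → PowerSeries.coeff r (PowerSeries.monomial m a) = 0 := fun r hr => by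
    rw [PowerSeries.coeff_monomial, if_neg hr]
  rw [evalOne_apply, lsum_eq_single _ m hzero, PowerSeries.coeff_monomial_same]
  intro r
  rcases eq_or_ne r m with rfl | hr
  · rwa [PowerSeries.coeff_monomial_same]
  · exact hzero r hr ▸ zero_mem _

theorem evalOne_mem_fil {P : A⟦X⟧} (hP : P ∈ gradedSeries fun r => fil k r) {N : ℕ}
    (hPN : P ∈ fil k N) : evalOne k A P ∈ fil k N :=
  lsum_mem_fil hP fun r => by
    rcases lt_or_ge r N with h | h
    · rw [hPN r h]; exact zero_mem _
    · exact fil_le h (hP r)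

variable [IsFilteredAlgebra k A]

theorem mul_mem_gradedSeries_fil {P Q : A⟦X⟧} (hP : P ∈ gradedSeries fun r => fil k r)
    (hQ : Q ∈ gradedSeries fun r => fil k r) : P * Q ∈ gradedSeries fun r => fil k r := fun r => by
  rw [PowerSeries.coeff_mul]
  exact sum_antidiagonal_mem_fil hP hQ r

theorem evalOne_mul {P Q : A⟦X⟧} (hP : P ∈ gradedSeries fun r => fil k r)
    (hQ : Q ∈ gradedSeries fun r => fil k r) :
    evalOne k A (P * Q) = evalOne k A P * evalOne k A Q := by
  simp only [evalOne_apply, lsum_mul_lsum hP hQ, PowerSeries.coeff_mul]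

theorem one_mem_gradedSeries_fil : (1 : A⟦X⟧) ∈ gradedSeries fun r => fil k r := fun r => by
  rw [PowerSeries.coeff_one]
  split_ifs with h
  · exact h ▸ one_mem_fil
  · exact zero_mem _

theorem pow_mem_gradedSeries_fil {P : A⟦X⟧} (hP : P ∈ gradedSeries fun r => fil k r) (r : ℕ) :
    P ^ r ∈ gradedSeries fun r => fil k r := by
  induction r with
  | zero => exact pow_zero P ▸ one_mem_gradedSeries_fil
  | succ r ih => exact pow_succ P r ▸ mul_mem_gradedSeries_fil ih hP

theorem evalOne_one : evalOne k A 1 = 1 := by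
  simpa only [PowerSeries.monomial_zero_eq_C, map_one] using
    evalOne_monomial (k := k) (A := A) one_mem_fil

theorem evalOne_pow {P : A⟦X⟧} (hP : P ∈ gradedSeries fun r => fil k r) (r : ℕ) :
    evalOne k A (P ^ r) = evalOne k A P ^ r := by
  induction r with
  | zero => rw [pow_zero, pow_zero, evalOne_one]
  | succ r ih => rw [pow_succ, pow_succ, evalOne_mul (pow_mem_gradedSeries_fil hP r) hP, ih]

theorem filExp_mem_gradedSeries_fil [CharZero k] {P : A⟦X⟧}
    (hP : P ∈ gradedSeries (fun r => fil k r) ⊓ fil k 1) :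
    filExp k P ∈ gradedSeries fun r => fil k r := by
  rw [filExp_eq_lsum]
  exact isSumClosed_gradedSeries (divPow_mem_fil hP.2)
    fun r => Submodule.smul_mem _ _ (pow_mem_gradedSeries_fil hP.1 r)

theorem evalOne_filExp [CharZero k] {P : A⟦X⟧}
    (hP : P ∈ gradedSeries (fun r => fil k r) ⊓ fil k 1) :
    evalOne k A (filExp k P) = filExp k (evalOne k A P) := by
  rw [filExp_eq_lsum, filExp_eq_lsum, map_lsum_of_mem _ isSumClosed_gradedSeries
    (fun N Q hQ hQN => evalOne_mem_fil hQ hQN) (divPow_mem_fil hP.2)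
    fun r => Submodule.smul_mem _ _ (pow_mem_gradedSeries_fil hP.1 r)]
  simp only [map_smul, evalOne_pow hP.1]

/-- The Baker–Campbell–Hausdorff theorem, obtained from the one over `A⟦X⟧` by scaling the elements
of `L 1` by the formal parameter `X` and specializing to `X = 1`. -/
theorem exists_filExp_lsum_eq_mul [CharZero k] {L : ℕ → Submodule k A}
    (hL : ∀ m n : ℕ, ∀ a ∈ L m, ∀ b ∈ L n, ⁅a, b⁆ ∈ L (m + n)) (hfil : ∀ r, L r ≤ fil k r)
    {u v : A} (hu : u ∈ L 1) (hv : v ∈ L 1) :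
    ∃ a : ℕ → A, (∀ r, a r ∈ L r) ∧ filExp k (lsum k a) = filExp k u * filExp k v := by
  have hle : gradedSeries L ⊓ fil k 1 ≤ gradedSeries (fun r => fil k r) ⊓ fil k 1 :=
    inf_le_inf_right _ fun P hP r => hfil r (hP r)
  have hmono : ∀ a ∈ L 1, PowerSeries.monomial 1 a ∈ gradedSeries L ⊓ fil k 1 := fun a ha => by
    refine ⟨fun r => ?_, fun r hr => by rw [PowerSeries.coeff_monomial, if_neg hr.ne]⟩
    rw [PowerSeries.coeff_monomial]
    split_ifs with h
    · exact h ▸ ha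
    · exact zero_mem _
  obtain ⟨W, hW, hWexp⟩ :=
    exists_filExp_eq_mul_of_mem_gradedSeries hL (hmono u hu) (hmono v hv)
  refine ⟨fun r => PowerSeries.coeff r W, hW.1, ?_⟩
  rw [← evalOne_apply, ← evalOne_filExp (hle hW), hWexp,
    evalOne_mul (filExp_mem_gradedSeries_fil (hle (hmono u hu)))
      (filExp_mem_gradedSeries_fil (hle (hmono v hv))),
    evalOne_filExp (hle (hmono u hu)), evalOne_filExp (hle (hmono v hv)),
    evalOne_monomial (hfil 1 hu), evalOne_monomial (hfil 1 hv)]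

end EvalOne

/-! ### Tangential derivations -/

section Lie

variable {k : Type*} [Field k] {n : ℕ}

/-- The homogeneous component of degree `d`, as a linear map. -/
def homogHom (d : ℕ) : Ass k n →ₗ[k] Ass k n where
  toFun := homog d
  map_add' f g := by ext w; by_cases h : w.length = d <;> simp [homog, h]
  map_smul' c f := by ext w; by_cases h : w.length = d <;> simp [homog, h]

theorem homogHom_apply (d : ℕ) (f : Ass k n) : homogHom d f = homog d f := rfl

theorem homog_eq_of_sub_mem_fil {d N : ℕ} {f g : Ass k n} (h : f - g ∈ fil k N) (hd : d < N) :
    homog d f = homog d g := by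
  ext w
  by_cases hw : w.length = d
  · simpa [homog, hw, sub_eq_zero] using h w (hw ▸ hd)
  · simp [homog, hw]

theorem sub_sum_homog_mem_fil (f : Ass k n) (N : ℕ) :
    f - ∑ d ∈ Finset.range N, homog d f ∈ fil k N := by
  intro w hw
  rw [Ass.sub_apply, Ass.sum_apply, Finset.sum_eq_single w.length]
  · simp [homog]
  · intro d _ hd; simp [homog, hd.symm]
  · intro h; exact absurd (Finset.mem_range.2 hw) h

theorem homog_mul_homog_apply (f g : Ass k n) (p q : ℕ) (w : List (Fin n)) :
    (homog p f * homog q g) w = if w.length = p + q then f (w.take p) * g (w.drop p) else 0 := by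
  rw [Ass.mul_apply]
  split_ifs with hw
  · rw [Finset.sum_eq_single_of_mem p (Finset.mem_range.2 (by omega))]
    · simp [homog, hw]
    · intro i hi hip
      rw [Finset.mem_range] at hi
      simp only [homog, List.length_take]
      rw [if_neg (by omega), zero_mul]
  · refine Finset.sum_eq_zero fun i hi => ?_
    rw [Finset.mem_range] at hi
    simp only [homog, List.length_take, List.length_drop]
    split_ifs <;> first | omega | simp

theorem homog_mul (f g : Ass k n) (d : ℕ) :
    homog d (f * g) = ∑ p ∈ antidiagonal d, homog p.1 f * homog p.2 g := by
  ext w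
  simp only [Ass.sum_apply, homog_mul_homog_apply]
  rw [Finset.sum_congr rfl fun p hp => by rw [mem_antidiagonal.1 hp]]
  by_cases hw : w.length = d
  · simp only [homog, hw, if_true, Ass.mul_apply]
    rw [Finset.Nat.sum_antidiagonal_eq_sum_range_succ fun i _ => f (w.take i) * g (w.drop i)]
  · simp [homog, hw]

theorem lie_mem_lie {f g : Ass k n} (hf : f ∈ lie k n) (hg : g ∈ lie k n) : ⁅f, g⁆ ∈ lie k n := by
  intro d
  rw [LieRing.of_associative_ring_bracket, ← homogHom_apply, map_sub, homogHom_apply,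
    homogHom_apply, homog_mul, homog_mul,
    ← Finset.Nat.sum_antidiagonal_swap (f := fun p => homog p.1 g * homog p.2 f),
    ← Finset.sum_sub_distrib]
  exact sum_mem fun p _ => LieSubalgebra.lie_mem _ (hf p.1) (hg p.2)

variable (k n) in
/-- The completed free Lie algebra `lie_n`, as a Lie subalgebra of `Ass_n`. -/
def lieSubalgebra : LieSubalgebra k (Ass k n) where
  carrier := lie k n
  add_mem' hf hg d := by
    rw [← homogHom_apply, map_add]
    exact add_mem (hf d) (hg d)
  zero_mem' d := by
    rw [← homogHom_apply, map_zero]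
    exact zero_mem _
  smul_mem' c f hf d := by
    rw [← homogHom_apply, map_smul]
    exact (LieSubalgebra.lieSpan k (Ass k n) (Set.range X)).smul_mem c (hf d)
  lie_mem' := lie_mem_lie

theorem X_mem_lieSubalgebra (i : Fin n) : X i ∈ lieSubalgebra k n := by
  intro d
  rcases eq_or_ne d 1 with rfl | hd
  · have : homog 1 (X i : Ass k n) = X i := by
      ext w
      by_cases hw : w = [i] <;> simp [homog, X, hw]
    rw [this]
    exact LieSubalgebra.subset_lieSpan ⟨i, rfl⟩
  · have : homog d (X i : Ass k n) = 0 := by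
      ext w
      by_cases hw : w = [i] <;> simp [homog, X, hw, hd.symm]
    rw [this]
    exact zero_mem _

theorem isSumClosed_lieSubalgebra : IsSumClosed k (lieSubalgebra k n).toSubmodule :=
  fun a ha hlie d => by
    rw [homog_eq_of_sub_mem_fil (lsum_sub_sum_mem ha (d + 1)) d.lt_succ_self]
    exact (sum_mem fun r _ => hlie r :
      ∑ r ∈ Finset.range (d + 1), a r ∈ (lieSubalgebra k n).toSubmodule) d

theorem X_mem_fil_one (i : Fin n) : (X i : Ass k n) ∈ fil k 1 := Ass.mem_fil_one.2 (X_nil i)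

end Lie

namespace TDer

variable {k : Type*} [Field k] {n : ℕ}

theorem toEnd_mem_fil (u : TDer k n) : u.toEnd ∈ fil k 1 :=
  fun p f hf => u.toEnd_apply_eq_zero f p hf

theorem comp_mem_fil (u : TDer k n) (i : Fin n) : u.comp i ∈ fil k 1 :=
  Ass.mem_fil_one.2 (u.comp_nil i)

theorem toEnd_lie (u : TDer k n) (f g : Ass k n) :
    u.toEnd ⁅f, g⁆ = ⁅u.toEnd f, g⁆ + ⁅f, u.toEnd g⁆ := by
  simp only [LieRing.of_associative_ring_bracket, map_sub, u.leibniz]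
  abel

theorem toEnd_mem_of_mem_lieSpan (u : TDer k n) {f : Ass k n}
    (hf : f ∈ LieSubalgebra.lieSpan k (Ass k n) (Set.range X)) :
    u.toEnd f ∈ lieSubalgebra k n := by
  have hle : LieSubalgebra.lieSpan k (Ass k n) (Set.range X) ≤ lieSubalgebra k n :=
    LieSubalgebra.lieSpan_le.2 (Set.range_subset_iff.2 X_mem_lieSubalgebra)
  induction hf using LieSubalgebra.lieSpan_induction with
  | mem f hf =>
    obtain ⟨i, rfl⟩ := hf
    rw [u.map_X]
    exact lie_mem_lie (X_mem_lieSubalgebra i) (u.comp_mem i)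
  | zero => rw [map_zero]; exact zero_mem _
  | add f g _ _ hf hg => rw [map_add]; exact add_mem hf hg
  | smul c f _ hf => rw [map_smul]; exact (lieSubalgebra k n).smul_mem c hf
  | lie f g hf' hg' hf hg =>
    rw [toEnd_lie]
    exact add_mem (lie_mem_lie hf (hle hg')) (lie_mem_lie (hle hf') hg)

theorem toEnd_mem_lieSubalgebra (u : TDer k n) {f : Ass k n} (hf : f ∈ lie k n) :
    u.toEnd f ∈ lieSubalgebra k n := fun d => by
  have hmod := u.toEnd_mem_fil _ _ (sub_sum_homog_mem_fil f (d + 1))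
  rw [map_sub] at hmod
  rw [homog_eq_of_sub_mem_fil hmod (by omega)]
  exact u.toEnd_mem_of_mem_lieSpan (sum_mem fun e _ => hf e) d

/-- `u` raises the degree by at least `m`. -/
def HasOrder (u : TDer k n) (m : ℕ) : Prop := u.toEnd ∈ fil k m ∧ ∀ i, u.comp i ∈ fil k m

theorem hasOrder_one (u : TDer k n) : u.HasOrder 1 := ⟨u.toEnd_mem_fil, u.comp_mem_fil⟩

instance : Zero (TDer k n) where
  zero :=
    { toEnd := 0
      comp := 0
      leibniz f g := by simp
      comp_mem _ := zero_mem (lieSubalgebra k n)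
      normalized _ := rfl
      map_X i := by simp }

instance : Add (TDer k n) where
  add u v :=
    { toEnd := u.toEnd + v.toEnd
      comp := u.comp + v.comp
      leibniz f g := by
        simp only [LinearMap.add_apply, u.leibniz, v.leibniz, add_mul, mul_add]; abel
      comp_mem i := add_mem (S := LieSubalgebra k (Ass k n)) (s := lieSubalgebra k n)
        (u.comp_mem i) (v.comp_mem i)
      normalized i := by simp [u.normalized, v.normalized]
      map_X i := by
        simp only [LinearMap.add_apply, u.map_X, v.map_X, Pi.add_apply, add_mul, mul_add]; abel }

instance : SMul k (TDer k n) where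
  smul c u :=
    { toEnd := c • u.toEnd
      comp := c • u.comp
      leibniz f g := by
        simp only [LinearMap.smul_apply, u.leibniz, smul_add, smul_mul_assoc, mul_smul_comm]
      comp_mem i := (lieSubalgebra k n).smul_mem c (u.comp_mem i)
      normalized i := by simp [u.normalized]
      map_X i := by
        simp only [LinearMap.smul_apply, u.map_X, Pi.smul_apply, smul_sub, smul_mul_assoc,
          mul_smul_comm] }

instance : Neg (TDer k n) := ⟨fun u => (-1 : k) • u⟩

theorem lie_comp_mem_fil (u v : TDer k n) (i : Fin n) {p q : ℕ} (hu : u.HasOrder p)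
    (hv : v.HasOrder q) :
    u.toEnd (v.comp i) - v.toEnd (u.comp i) + ⁅u.comp i, v.comp i⁆ ∈ fil k (p + q) :=
  add_mem (sub_mem (add_comm q p ▸ hu.1 _ _ (hv.2 i)) (hv.1 _ _ (hu.2 i)))
    (lie_mem_fil k (hu.2 i) (hv.2 i))

instance : Bracket (TDer k n) (TDer k n) where
  bracket u v :=
    { toEnd := ⁅u.toEnd, v.toEnd⁆
      comp i := u.toEnd (v.comp i) - v.toEnd (u.comp i) + ⁅u.comp i, v.comp i⁆
      leibniz f g := by
        simp only [LieRing.of_associative_ring_bracket, LinearMap.sub_apply, Module.End.mul_apply,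
          u.leibniz, v.leibniz, map_add]
        noncomm_ring
      comp_mem i := add_mem (S := LieSubalgebra k (Ass k n)) (s := lieSubalgebra k n)
        (sub_mem (u.toEnd_mem_lieSubalgebra (v.comp_mem i))
          (v.toEnd_mem_lieSubalgebra (u.comp_mem i)))
        (lie_mem_lie (u.comp_mem i) (v.comp_mem i))
      normalized i := lie_comp_mem_fil u v i u.hasOrder_one v.hasOrder_one [i] (by simp)
      map_X i := by
        simp only [LieRing.of_associative_ring_bracket, LinearMap.sub_apply, Module.End.mul_apply,
          u.map_X, v.map_X, map_sub, u.leibniz, v.leibniz]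
        noncomm_ring }

theorem zero_toEnd : (0 : TDer k n).toEnd = 0 := rfl
theorem add_toEnd (u v : TDer k n) : (u + v).toEnd = u.toEnd + v.toEnd := rfl
theorem add_comp (u v : TDer k n) (i : Fin n) : (u + v).comp i = u.comp i + v.comp i := rfl
theorem smul_toEnd (c : k) (u : TDer k n) : (c • u).toEnd = c • u.toEnd := rfl
theorem neg_toEnd (u : TDer k n) : (-u).toEnd = -u.toEnd := neg_one_smul k _
theorem lie_toEnd (u v : TDer k n) : ⁅u, v⁆.toEnd = ⁅u.toEnd, v.toEnd⁆ := rfl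
theorem lie_comp (u v : TDer k n) (i : Fin n) :
    ⁅u, v⁆.comp i = u.toEnd (v.comp i) - v.toEnd (u.comp i) + ⁅u.comp i, v.comp i⁆ := rfl

theorem hasOrder_zero (m : ℕ) : (0 : TDer k n).HasOrder m := ⟨zero_mem _, fun _ => zero_mem _⟩

theorem HasOrder.add {u v : TDer k n} {m : ℕ} (hu : u.HasOrder m) (hv : v.HasOrder m) :
    (u + v).HasOrder m := ⟨add_mem hu.1 hv.1, fun i => add_mem (hu.2 i) (hv.2 i)⟩

theorem HasOrder.smul (c : k) {u : TDer k n} {m : ℕ} (hu : u.HasOrder m) : (c • u).HasOrder m :=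
  ⟨Submodule.smul_mem _ c hu.1, fun i => Submodule.smul_mem _ c (hu.2 i)⟩

theorem HasOrder.lie {u v : TDer k n} {p q : ℕ} (hu : u.HasOrder p) (hv : v.HasOrder q) :
    (⁅u, v⁆).HasOrder (p + q) :=
  ⟨lie_mem_fil k hu.1 hv.1, fun i => lie_comp_mem_fil u v i hu hv⟩

/-- The sum of a series of tangential derivations of increasing orders. -/
def sum (w : ℕ → TDer k n) (hw : ∀ r, (w r).HasOrder r) : TDer k n where
  toEnd := lsum k fun r => (w r).toEnd
  comp i := lsum k fun r => (w r).comp i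
  leibniz f g := by
    simp only [lsum_end_apply, (w _).leibniz, lsum_add]
    rw [lsum_mul (fun r => end_apply_mem_fil (hw r).1 f) g.mem_fil_zero,
      mul_lsum (fun r => end_apply_mem_fil (hw r).1 g) f.mem_fil_zero]
  comp_mem i := isSumClosed_lieSubalgebra (fun r => (hw r).2 i) fun r => (w r).comp_mem i
  normalized i := by
    rw [Ass.lsum_apply]
    exact Finset.sum_eq_zero fun r _ => (w r).normalized i
  map_X i := by
    simp only [lsum_end_apply, (w _).map_X, lsum_sub]
    rw [lsum_mul (fun r => (hw r).2 i) (X i).mem_fil_zero,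
      mul_lsum (fun r => (hw r).2 i) (X i).mem_fil_zero]

end TDer

/-! ### Cyclic words and divergence -/

section PartialDerivatives

variable {k : Type*} [Field k] {n : ℕ}

theorem mul_X_append (f : Ass k n) (i j : Fin n) (w : List (Fin n)) :
    (f * X i : Ass k n) (w ++ [j]) = if i = j then f w else 0 := by
  rw [Ass.mul_apply, Finset.sum_eq_single w.length]
  · rw [List.take_left' rfl, List.drop_left' rfl]
    by_cases h : i = j
    · simp [X, h]
    · simp [X, h, Ne.symm h]
  · intro l hl hne
    have hX : (X i : Ass k n) (List.drop l (w ++ [j])) = 0 := by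
      simp only [X, ite_eq_right_iff]
      intro h
      have := congrArg List.length h
      simp at this hl
      omega
    rw [hX, mul_zero]
  · simp

theorem X_mul_cons (f : Ass k n) (i j : Fin n) (w : List (Fin n)) :
    (X i * f : Ass k n) (j :: w) = if i = j then f w else 0 := by
  have hshift : Ass.lshift j (X i : Ass k n) = if i = j then 1 else 0 := by
    ext v
    by_cases h : i = j
    · subst h; simp [Ass.lshift, X, Ass.one_apply]
    · simp [Ass.lshift, X, h, Ne.symm h]
  rw [Ass.mul_cons, X_nil, zero_mul, zero_add, hshift]
  split_ifs <;> simp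

theorem eq_add_sum_partialR_mul_X (f : Ass k n) : f = f [] • 1 + ∑ i, partialR i f * X i := by
  ext w
  rw [Ass.add_apply, Ass.smul_apply, Ass.sum_apply, Ass.one_apply]
  rcases List.eq_nil_or_concat w with rfl | ⟨v, j, rfl⟩
  · simp [X_nil]
  · simp only [List.concat_eq_append, mul_X_append]
    simp [partialR]

/-- The operator `∂_i`, as a linear map. -/
def partialRHom (i : Fin n) : Ass k n →ₗ[k] Ass k n where
  toFun := partialR i
  map_add' _ _ := rfl
  map_smul' _ _ := rfl

theorem partialR_add (i : Fin n) (f g : Ass k n) :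
    partialR i (f + g) = partialR i f + partialR i g := rfl

theorem partialR_sub (i : Fin n) (f g : Ass k n) :
    partialR i (f - g) = partialR i f - partialR i g := rfl

theorem partialR_sum (i : Fin n) {ι : Type*} (s : Finset ι) (f : ι → Ass k n) :
    partialR i (∑ j ∈ s, f j) = ∑ j ∈ s, partialR i (f j) :=
  map_sum (partialRHom i) f s

theorem partialR_mul (i : Fin n) (f g : Ass k n) :
    partialR i (f * g) = f * partialR i g + g [] • partialR i f := by
  ext w
  rw [Ass.add_apply, Ass.smul_apply, Ass.mul_apply]
  change (f * g) (w ++ [i]) = _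
  rw [Ass.mul_apply, List.length_append, List.length_singleton, Finset.sum_range_succ]
  congr 1
  · refine Finset.sum_congr rfl fun j hj => ?_
    have hj' : j ≤ w.length := by simpa [Nat.lt_succ_iff] using hj
    rw [List.take_append_of_le_length hj', List.drop_append_of_le_length hj']
    rfl
  · rw [List.take_of_length_le (by simp), List.drop_of_length_le (by simp), mul_comm]
    rfl

theorem partialR_X (i j : Fin n) : partialR i (X j : Ass k n) = if j = i then 1 else 0 := by
  ext w
  cases w with
  | nil =>
    by_cases h : j = i
    · simp [partialR, X, h, Ass.one_apply]
    · simp [partialR, X, h, Ne.symm h]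
  | cons a w => by_cases h : j = i <;> simp [partialR, X, h, Ass.one_apply]

theorem X_mul_partialR_mem_fil (i : Fin n) {N : ℕ} {f : Ass k n} (hf : f ∈ fil k N) :
    X i * partialR i f ∈ fil k N := by
  have hpartial : partialR i f ∈ fil k (N - 1) := fun w hw => hf _ (by simp; omega)
  exact fil_le (by omega) (mul_mem_fil (X_mem_fil_one i) hpartial)

end PartialDerivatives

section Trace

variable {k : Type*} [Field k] {n : ℕ}

/-- Summation over the cyclic rotations of a word. In characteristic zero, its kernel is `trKer`,
so that it identifies `tr_n` with a space of cyclically invariant series. -/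
def cyc : Ass k n →ₗ[k] Ass k n where
  toFun f := ⟨fun w => ∑ i ∈ Finset.range w.length, f (w.rotate i)⟩
  map_add' f g := by ext w; simp [Finset.sum_add_distrib]
  map_smul' c f := by ext w; simp [Finset.mul_sum]

theorem cyc_apply (f : Ass k n) (w : List (Fin n)) :
    cyc f w = ∑ i ∈ Finset.range w.length, f (w.rotate i) := rfl

theorem sum_rotate_add {M : Type*} [AddCommMonoid M] {α : Type*} (H : List α → M) (w : List α)
    (j : ℕ) : ∑ i ∈ Finset.range w.length, H (w.rotate (i + j)) =
      ∑ i ∈ Finset.range w.length, H (w.rotate i) := by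
  induction j with
  | zero => rfl
  | succ j ih =>
    rw [← ih]
    rcases Nat.eq_zero_or_pos w.length with h | h
    · simp [h]
    obtain ⟨d, hd⟩ : ∃ d, w.length = d + 1 := ⟨w.length - 1, by omega⟩
    rw [hd, Finset.sum_range_succ, Finset.sum_range_succ']
    congr 1
    · exact Finset.sum_congr rfl fun i _ => by rw [add_assoc, add_comm 1 j]
    · rw [show d + (j + 1) = (d + 1) + j by omega, ← hd, ← List.rotate_rotate, List.rotate_length,
        zero_add]

theorem cyc_mul_comm (a b : Ass k n) : cyc (a * b) = cyc (b * a) := by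
  ext w
  simp only [cyc_apply, Ass.mul_apply, List.length_rotate]
  rw [Finset.sum_comm, Finset.sum_comm (s := Finset.range w.length),
    ← Finset.sum_range_reflect _ (w.length + 1)]
  refine Finset.sum_congr rfl fun j hj => ?_
  have hj' : j ≤ w.length := by simpa [Nat.lt_succ_iff] using hj
  rw [Nat.add_sub_cancel,
    ← sum_rotate_add (fun v => b (v.take j) * a (v.drop j)) w (w.length - j)]
  refine Finset.sum_congr rfl fun i _ => ?_
  rw [← List.rotate_rotate, mul_comm]
  set v := w.rotate i with hv
  have hlen : v.length = w.length := by simp [hv]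
  have hdrop : (v.drop (w.length - j)).length = j := by
    rw [List.length_drop]; omega
  rw [List.rotate_eq_drop_append_take (by omega), List.take_left' hdrop, List.drop_left' hdrop]

theorem commutator_mem_trKer (a b : Ass k n) : a * b - b * a ∈ trKer k n :=
  Submodule.subset_span (Or.inr ⟨a, b, rfl⟩)

theorem one_mem_trKer : (1 : Ass k n) ∈ trKer k n := Submodule.subset_span (Or.inl rfl)

theorem trKer_le {S : Submodule k (Ass k n)} (h1 : (1 : Ass k n) ∈ S)
    (hcomm : ∀ a b : Ass k n, a * b - b * a ∈ S) : trKer k n ≤ S := by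
  rw [trKer, Submodule.span_le]
  rintro _ (rfl | ⟨a, b, rfl⟩)
  exacts [h1, hcomm a b]

theorem cyc_one : cyc (1 : Ass k n) = 0 := by
  ext w
  rw [cyc_apply, Ass.zero_apply]
  refine Finset.sum_eq_zero fun i hi => ?_
  rw [Ass.one_apply, if_neg]
  rw [List.rotate_eq_nil_iff]
  rintro rfl
  simp at hi

theorem trKer_le_ker_cyc : trKer k n ≤ LinearMap.ker cyc :=
  trKer_le (LinearMap.mem_ker.2 cyc_one) fun a b => by
    rw [LinearMap.mem_ker, map_sub, cyc_mul_comm, sub_self]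

/-- Rotation of words by one letter; a series and its rotation have the same trace. -/
def rot (f : Ass k n) : Ass k n := ⟨fun w => f (w.rotate 1)⟩

theorem rot_eq (f : Ass k n) : rot f = f [] • 1 + ∑ i, X i * partialR i f := by
  ext w
  rw [Ass.add_apply, Ass.smul_apply, Ass.sum_apply, Ass.one_apply]
  cases w with
  | nil => simp [X_nil, rot]
  | cons j v =>
    simp only [X_mul_cons]
    simp [partialR, rot]

theorem sub_rot_mem_trKer (f : Ass k n) : f - rot f ∈ trKer k n := by
  rw [rot_eq]
  nth_rw 1 [eq_add_sum_partialR_mul_X f]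
  rw [add_sub_add_left_eq_sub, ← Finset.sum_sub_distrib]
  exact sum_mem fun i _ => commutator_mem_trKer _ _

/-- If the rotations of `f` sum to zero, averaging the partial sums of the rotations solves
`f = g - rot g`. -/
theorem exists_eq_add_sub_rot [CharZero k] {f : Ass k n} (hf : cyc f = 0) :
    ∃ g, f = f [] • 1 + (g - rot g) := by
  refine ⟨⟨fun w => (w.length : k)⁻¹ *
    ∑ i ∈ Finset.range w.length, ∑ j ∈ Finset.range i, f (w.rotate j)⟩, ?_⟩
  ext w
  rw [Ass.add_apply, Ass.smul_apply, Ass.one_apply, Ass.sub_apply]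
  by_cases hw : w = []
  · subst hw; simp [rot]
  have hlen : (w.length : k) ≠ 0 := Nat.cast_ne_zero.2 (by simpa using hw)
  have htelescope : ∀ i, ∑ j ∈ Finset.range i, f (w.rotate j) -
      ∑ j ∈ Finset.range i, f ((w.rotate 1).rotate j) = f w - f (w.rotate i) := fun i => by
    rw [← Finset.sum_sub_distrib]
    simp only [List.rotate_rotate, add_comm 1]
    rw [Finset.sum_range_sub' (fun j => f (w.rotate j)), List.rotate_zero]
  simp only [rot, List.length_rotate, if_neg hw, mul_zero, zero_add]
  rw [← mul_sub, ← Finset.sum_sub_distrib, eq_inv_mul_iff_mul_eq₀ hlen]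
  simp only [htelescope, Finset.sum_sub_distrib]
  rw [← cyc_apply, hf]
  simp

theorem mem_trKer_iff_cyc_eq_zero [CharZero k] {f : Ass k n} : f ∈ trKer k n ↔ cyc f = 0 := by
  refine ⟨fun h => trKer_le_ker_cyc h, fun h => ?_⟩
  obtain ⟨g, hg⟩ := exists_eq_add_sub_rot h
  rw [hg]
  exact add_mem (Submodule.smul_mem _ _ one_mem_trKer) (sub_rot_mem_trKer g)

theorem isSumClosed_trKer [CharZero k] : IsSumClosed k (trKer k n) := fun f _ hf => by
  rw [mem_trKer_iff_cyc_eq_zero]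
  ext w
  have hterm : ∀ r, ∑ i ∈ Finset.range w.length, f r (w.rotate i) = 0 := fun r =>
    congrFun (congrArg Ass.coeff (mem_trKer_iff_cyc_eq_zero.1 (hf r))) w
  simp only [cyc_apply, Ass.lsum_apply, List.length_rotate]
  rw [Finset.sum_comm]
  exact Finset.sum_eq_zero fun r _ => hterm r

theorem Tr_eq_zero_iff {f : Ass k n} : Tr f = 0 ↔ f ∈ trKer k n :=
  Submodule.Quotient.mk_eq_zero _

theorem Tr_eq_Tr_iff {f g : Ass k n} : Tr f = Tr g ↔ f - g ∈ trKer k n :=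
  Submodule.Quotient.eq _

theorem Tr_surjective : Function.Surjective (Tr : Ass k n → tr k n) :=
  Submodule.mkQ_surjective _

theorem Tr_mul_comm (a b : Ass k n) : Tr (a * b) = Tr (b * a) :=
  Tr_eq_Tr_iff.2 (commutator_mem_trKer a b)

theorem Tr_lie (a b : Ass k n) : Tr ⁅a, b⁆ = 0 :=
  Tr_eq_zero_iff.2 (commutator_mem_trKer a b)

theorem Tr_lsum_eq_of_forall [CharZero k] {a b : ℕ → Ass k n} (ha : ∀ r, a r ∈ fil k r)
    (hb : ∀ r, b r ∈ fil k r) (h : ∀ r, Tr (a r) = Tr (b r)) : Tr (lsum k a) = Tr (lsum k b) := by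
  rw [Tr_eq_Tr_iff, ← lsum_sub]
  exact isSumClosed_trKer (fun r => sub_mem (ha r) (hb r)) fun r => Tr_eq_Tr_iff.1 (h r)

end Trace

namespace TDer

variable {k : Type*} [Field k] {n : ℕ}

theorem toEnd_one (u : TDer k n) : u.toEnd 1 = 0 := by simpa using u.leibniz 1 1

theorem toEnd_mem_trKer (u : TDer k n) {f : Ass k n} (hf : f ∈ trKer k n) :
    u.toEnd f ∈ trKer k n := by
  refine trKer_le (S := (trKer k n).comap u.toEnd) ?_ (fun a b => ?_) hf
  · rw [Submodule.mem_comap, u.toEnd_one]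
    exact zero_mem _
  · rw [Submodule.mem_comap, ← LieRing.of_associative_ring_bracket, toEnd_lie]
    exact add_mem (commutator_mem_trKer _ _) (commutator_mem_trKer _ _)

theorem divRep_mem_fil {u : TDer k n} {m : ℕ} (hu : u.HasOrder m) : u.divRep ∈ fil k m :=
  sum_mem fun i _ => X_mul_partialR_mem_fil i (hu.2 i)

theorem divRep_zero : (0 : TDer k n).divRep = 0 :=
  Finset.sum_eq_zero fun i _ => mul_zero (X i)

theorem divRep_add (u v : TDer k n) : (u + v).divRep = u.divRep + v.divRep := by
  simp only [divRep, add_comp, partialR_add, mul_add, Finset.sum_add_distrib]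

theorem divRep_smul (c : k) (u : TDer k n) : (c • u).divRep = c • u.divRep := by
  have hpartial : ∀ i, partialR i ((c • u).comp i) = c • partialR i (u.comp i) := fun _ => rfl
  simp only [divRep, hpartial, mul_smul_comm, Finset.smul_sum]

theorem divRep_sum (w : ℕ → TDer k n) (hw : ∀ r, (w r).HasOrder r) :
    (sum w hw).divRep = lsum k fun r => (w r).divRep := by
  have hterm : ∀ i, X i * partialR i ((sum w hw).comp i) =
      lsum k fun r => X i * partialR i ((w r).comp i) := fun i =>
    map_lsum (LinearMap.mulLeft k (X i) ∘ₗ partialRHom i)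
      (fun _ _ hf => X_mul_partialR_mem_fil i hf) fun r => (hw r).2 i
  simp only [divRep, hterm]
  ext v
  simp only [Ass.sum_apply, Ass.lsum_apply]
  exact Finset.sum_comm

theorem partialR_toEnd (u : TDer k n) (i : Fin n) (b : Ass k n) :
    partialR i (u.toEnd b) = u.toEnd (partialR i b) - partialR i b * u.comp i +
      ∑ l, partialR l b * X l * partialR i (u.comp l) := by
  conv_lhs => rw [eq_add_sum_partialR_mul_X b]
  rw [map_add, map_smul, u.toEnd_one, smul_zero, zero_add, map_sum, partialR_sum]
  have hterm : ∀ l, partialR i (u.toEnd (partialR l b * X l)) =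
      (if l = i then u.toEnd (partialR i b) - partialR i b * u.comp i else 0) +
        partialR l b * X l * partialR i (u.comp l) := by
    intro l
    rw [u.leibniz, u.map_X, partialR_add, partialR_mul, partialR_mul, partialR_sub, partialR_mul,
      partialR_mul, partialR_X, Ass.sub_apply, Ass.mul_nil, Ass.mul_nil, X_nil, u.comp_nil]
    by_cases h : l = i
    · subst h; simp [mul_sub, mul_assoc]; abel
    · simp [h, mul_assoc]
  simp only [hterm, Finset.sum_add_distrib]
  simp

theorem X_mul_partialR_lie_comp (u v : TDer k n) (i : Fin n) :
    X i * partialR i (⁅u, v⁆.comp i) =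
      (u.toEnd (X i * partialR i (v.comp i)) - v.toEnd (X i * partialR i (u.comp i))) +
      (⁅u.comp i, X i * partialR i (v.comp i)⁆ - ⁅v.comp i, X i * partialR i (u.comp i)⁆) +
      ∑ l, (X i * partialR l (v.comp i) * (X l * partialR i (u.comp l)) -
        X i * partialR l (u.comp i) * (X l * partialR i (v.comp l))) := by
  rw [lie_comp, partialR_add, partialR_sub, partialR_toEnd, partialR_toEnd,
    LieRing.of_associative_ring_bracket, partialR_sub, partialR_mul, partialR_mul, u.comp_nil,
    v.comp_nil, zero_smul, zero_smul, Finset.sum_sub_distrib]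
  simp only [LieRing.of_associative_ring_bracket, u.leibniz, v.leibniz, u.map_X, v.map_X, mul_add,
    mul_sub, Finset.mul_sum]
  noncomm_ring

theorem div_lie (u v : TDer k n) :
    ⁅u, v⁆.div = Tr (u.toEnd v.divRep - v.toEnd u.divRep) := by
  have hswap : ∑ i, ∑ l, Tr (X i * partialR l (v.comp i) * (X l * partialR i (u.comp l))) =
      ∑ i, ∑ l, Tr (X i * partialR l (u.comp i) * (X l * partialR i (v.comp l))) := by
    rw [Finset.sum_comm]
    exact Finset.sum_congr rfl fun i _ => Finset.sum_congr rfl fun l _ => Tr_mul_comm _ _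
  simp only [div, divRep, X_mul_partialR_lie_comp, map_sum, map_add, map_sub, Tr_lie,
    Finset.sum_add_distrib, Finset.sum_sub_distrib, hswap, sub_self, add_zero]

end TDer

/-! ### The cocycle identity for `j` -/

section Operators

variable {k : Type*} [Field k] {n : ℕ} {T : Module.End k (Ass k n)}

theorem seriesEval_end_apply (T : Module.End k (Ass k n)) (P : k⟦X⟧) (f : Ass k n) :
    seriesEval T P f = lsum k fun r => PowerSeries.coeff r P • (T ^ r) f := rfl

theorem coeff_smul_pow_apply_mem_fil (hT : T ∈ fil k 1) (P : k⟦X⟧) (f : Ass k n) (r : ℕ) :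
    PowerSeries.coeff r P • (T ^ r) f ∈ fil k r :=
  end_apply_mem_fil (coeff_smul_pow_mem_fil hT P r) f

theorem seriesEval_mem_fil (hT : T ∈ fil k 1) (P : k⟦X⟧) : seriesEval T P ∈ fil k 0 :=
  lsum_mem_fil (coeff_smul_pow_mem_fil hT P)
    fun r => fil_le r.zero_le (coeff_smul_pow_mem_fil hT P r)

theorem seriesEval_apply_mem_fil (hT : T ∈ fil k 1) (P : k⟦X⟧) {f : Ass k n} {N : ℕ}
    (hf : f ∈ fil k N) : seriesEval T P f ∈ fil k N :=
  seriesEval_mem_fil hT P N f hf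

theorem pow_apply_mem {S : Submodule k (Ass k n)} (hS : ∀ f ∈ S, T f ∈ S) {f : Ass k n}
    (hf : f ∈ S) (r : ℕ) : (T ^ r) f ∈ S := by
  induction r with
  | zero => exact hf
  | succ r ih => rw [pow_succ', Module.End.mul_apply]; exact hS _ ih

theorem seriesEval_apply_sub_mem (hT : T ∈ fil k 1) {S : Submodule k (Ass k n)}
    (hclosed : IsSumClosed k S) (hS : ∀ f ∈ S, T f ∈ S) (P : k⟦X⟧) {f : Ass k n}
    (hf : T f ∈ S) : seriesEval T P f - PowerSeries.coeff 0 P • f ∈ S := by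
  have hterm := coeff_smul_pow_apply_mem_fil hT P f
  rw [seriesEval_end_apply, lsum_succ hterm, pow_zero, Module.End.one_apply, add_sub_cancel_left]
  refine hclosed (fun r => fil_le r.le_succ (hterm (r + 1))) fun r => S.smul_mem _ ?_
  rw [pow_succ, Module.End.mul_apply]
  exact pow_apply_mem hS hf r

theorem seriesEval_apply_mem (hT : T ∈ fil k 1) {S : Submodule k (Ass k n)}
    (hclosed : IsSumClosed k S) (hS : ∀ f ∈ S, T f ∈ S) (P : k⟦X⟧) {f : Ass k n} (hf : f ∈ S) :
    seriesEval T P f ∈ S := by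
  have h := seriesEval_apply_sub_mem hT hclosed hS P (hS f hf)
  simpa using add_mem h (S.smul_mem (PowerSeries.coeff 0 P) hf)

variable (k) in
/-- The power series `(e ^ X - 1) / X`. -/
def expSubOneDivX : k⟦X⟧ := PowerSeries.mk fun r => ((r + 1).factorial : k)⁻¹

theorem coeff_zero_expSubOneDivX : PowerSeries.coeff 0 (expSubOneDivX k) = 1 := by
  simp [expSubOneDivX]

theorem constantCoeff_expSubOneDivX_ne_zero :
    PowerSeries.constantCoeff (expSubOneDivX k) ≠ 0 := by
  rw [← PowerSeries.coeff_zero_eq_constantCoeff_apply, coeff_zero_expSubOneDivX]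
  exact one_ne_zero

variable [CharZero k]

variable (k) in
theorem expSubOneDivX_mul_X_add_one :
    expSubOneDivX k * PowerSeries.X + 1 = PowerSeries.exp k := by
  ext r
  cases r with
  | zero => simp
  | succ r =>
    simp [expSubOneDivX, PowerSeries.coeff_succ_mul_X, PowerSeries.coeff_one]

variable (k) in
theorem evalNegHom_expSubOneDivX : PowerSeries.evalNegHom (expSubOneDivX k) =
    PowerSeries.evalNegHom (PowerSeries.exp k) * expSubOneDivX k := by
  refine mul_right_cancel₀ (PowerSeries.X_ne_zero (R := k)) ?_
  have hneg := congrArg (PowerSeries.evalNegHom (A := k)) (expSubOneDivX_mul_X_add_one k)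
  rw [map_add, map_mul, map_one, PowerSeries.evalNegHom_X] at hneg
  linear_combination -hneg - PowerSeries.exp_mul_exp_neg_eq_one (A := k) -
    PowerSeries.evalNegHom (PowerSeries.exp k) * expSubOneDivX_mul_X_add_one k

theorem filExp_end_apply (hT : T ∈ fil k 1) (f : Ass k n) :
    filExp k T f = seriesEval T (expSubOneDivX k) (T f) + f := by
  rw [filExp, ← expSubOneDivX_mul_X_add_one, map_add, seriesEval_mul hT, seriesEval_X hT,
    seriesEval_one hT, LinearMap.add_apply, Module.End.mul_apply, Module.End.one_apply]

end Operators

namespace TDer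

variable {k : Type*} [Field k] {n : ℕ}

theorem div_neg (u : TDer k n) : (-u).div = -u.div := by
  rw [div, div, ← map_neg, ← neg_one_smul k u.divRep, ← divRep_smul]
  rfl

theorem seriesEval_expSubOneDivX_inv_apply (u : TDer k n) (f : Ass k n) :
    seriesEval u.toEnd (expSubOneDivX k)⁻¹ (seriesEval u.toEnd (expSubOneDivX k) f) = f := by
  rw [← Module.End.mul_apply, ← seriesEval_mul u.toEnd_mem_fil,
    PowerSeries.inv_mul_cancel _ constantCoeff_expSubOneDivX_ne_zero,
    seriesEval_one u.toEnd_mem_fil, Module.End.one_apply]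

variable [CharZero k]

theorem exp_eq_filExp (u : TDer k n) : u.exp = filExp k u.toEnd := by
  rw [exp, filExp, ← opSeries_eq_seriesEval]
  simp only [coeff_exp]

theorem exp_apply (u : TDer k n) (f : Ass k n) :
    u.exp f = seriesEval u.toEnd (expSubOneDivX k) (u.toEnd f) + f := by
  rw [exp_eq_filExp, filExp_end_apply u.toEnd_mem_fil]

theorem exp_apply_of_toEnd_eq_zero {u : TDer k n} {f : Ass k n} (h : u.toEnd f = 0) :
    u.exp f = f := by
  rw [exp_apply, h, map_zero, zero_add]

theorem exp_one (u : TDer k n) : u.exp 1 = 1 := exp_apply_of_toEnd_eq_zero u.toEnd_one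

theorem exp_mem_fil (u : TDer k n) : u.exp ∈ fil k 0 :=
  u.exp_eq_filExp ▸ seriesEval_mem_fil u.toEnd_mem_fil _

theorem exp_apply_nil (u : TDer k n) (f : Ass k n) : u.exp f [] = f [] := by
  rw [exp_apply, Ass.add_apply, Ass.mem_fil_one.1 (seriesEval_apply_mem_fil u.toEnd_mem_fil _
    (end_apply_mem_fil u.toEnd_mem_fil f)), zero_add]

theorem exp_mul (u : TDer k n) (f g : Ass k n) : u.exp (f * g) = u.exp f * u.exp g := by
  have hpow : ∀ r, (LieAlgebra.ad k (Module.End k (Ass k n)) u.toEnd ^ r) (LinearMap.mulLeft k f) =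
      LinearMap.mulLeft k ((u.toEnd ^ r) f) := fun r => by
    induction r with
    | zero => rfl
    | succ r ih =>
      rw [pow_succ', Module.End.mul_apply, ih, LieAlgebra.ad_apply,
        lie_mulLeft_of_leibniz u.leibniz, pow_succ', Module.End.mul_apply]
  have hterm : ∀ r, (r.factorial : k)⁻¹ • (u.toEnd ^ r) f ∈ fil k r := fun r =>
    end_apply_mem_fil (divPow_mem_fil u.toEnd_mem_fil r) f
  have hexpAd : expAd k u.toEnd (LinearMap.mulLeft k f) = LinearMap.mulLeft k (u.exp f) := by
    ext1 h
    simp only [expAd, hpow, exp_eq_filExp, filExp_eq_lsum, lsum_end_apply, LinearMap.smul_apply,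
      LinearMap.mulLeft_apply]
    rw [lsum_mul hterm h.mem_fil_zero]
    simp only [smul_mul_assoc]
  have h := LinearMap.congr_fun
    (filExp_mul (k := k) u.toEnd_mem_fil (mulLeft_mem_fil f.mem_fil_zero)) g
  rwa [hexpAd, ← exp_eq_filExp] at h

theorem exp_mul_exp_neg (u : TDer k n) : u.exp * (-u).exp = 1 := by
  rw [exp_eq_filExp, exp_eq_filExp, neg_toEnd, filExp, filExp, seriesEval_neg,
    ← seriesEval_mul u.toEnd_mem_fil, PowerSeries.exp_mul_exp_neg_eq_one,
    seriesEval_one u.toEnd_mem_fil]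

theorem exp_neg_mul_exp (u : TDer k n) : (-u).exp * u.exp = 1 := by
  rw [exp_eq_filExp, exp_eq_filExp, neg_toEnd, filExp, filExp, seriesEval_neg,
    ← seriesEval_mul u.toEnd_mem_fil, mul_comm, PowerSeries.exp_mul_exp_neg_eq_one,
    seriesEval_one u.toEnd_mem_fil]

/-- The automorphism `exp(u)`, as an invertible operator. -/
def expUnit (u : TDer k n) : (Module.End k (Ass k n))ˣ :=
  ⟨u.exp, (-u).exp, u.exp_mul_exp_neg, u.exp_neg_mul_exp⟩

theorem toEnd_eq_zero_of_exp_apply_eq {u : TDer k n} {f : Ass k n} (h : u.exp f = f) :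
    u.toEnd f = 0 := by
  rw [exp_apply, add_eq_right] at h
  rw [← u.seriesEval_expSubOneDivX_inv_apply (u.toEnd f), h, map_zero]

/-- The operator `P(u)` on `tr_n`, for a power series `P`. -/
def trAction (u : TDer k n) (P : k⟦X⟧) : tr k n →ₗ[k] tr k n :=
  (trKer k n).mapQ (trKer k n) (seriesEval u.toEnd P) fun _ hf =>
    seriesEval_apply_mem u.toEnd_mem_fil isSumClosed_trKer (fun _ => u.toEnd_mem_trKer) P hf

theorem trAction_Tr (u : TDer k n) (P : k⟦X⟧) (f : Ass k n) :
    u.trAction P (Tr f) = Tr (seriesEval u.toEnd P f) := rfl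

theorem trAction_exp_Tr (u : TDer k n) (f : Ass k n) :
    u.trAction (PowerSeries.exp k) (Tr f) = Tr (u.exp f) := by
  rw [trAction_Tr, exp_eq_filExp, filExp]

theorem trAction_mul_apply (u : TDer k n) (P Q : k⟦X⟧) (x : tr k n) :
    u.trAction (P * Q) x = u.trAction P (u.trAction Q x) := by
  obtain ⟨f, rfl⟩ := Tr_surjective x
  simp only [trAction_Tr, seriesEval_mul u.toEnd_mem_fil, Module.End.mul_apply]

theorem trAction_one_apply (u : TDer k n) (x : tr k n) : u.trAction 1 x = x := by
  obtain ⟨f, rfl⟩ := Tr_surjective x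
  rw [trAction_Tr, seriesEval_one u.toEnd_mem_fil, Module.End.one_apply]

theorem trAction_neg (u : TDer k n) (P : k⟦X⟧) :
    (-u).trAction P = u.trAction (PowerSeries.evalNegHom P) := by
  ext x
  exact congrArg (fun T : Module.End k (Ass k n) => Tr (T x))
    ((congrArg (fun T => seriesEval T P) u.neg_toEnd).trans (seriesEval_neg u.toEnd P))

theorem trAction_exp_neg_trAction_exp (u : TDer k n) (x : tr k n) :
    (-u).trAction (PowerSeries.exp k) (u.trAction (PowerSeries.exp k) x) = x := by
  rw [trAction_neg, ← trAction_mul_apply, mul_comm, PowerSeries.exp_mul_exp_neg_eq_one,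
    trAction_one_apply]

theorem trAction_Tr_of_toEnd_mem_trKer (u : TDer k n) (P : k⟦X⟧) {f : Ass k n}
    (hf : u.toEnd f ∈ trKer k n) : u.trAction P (Tr f) = PowerSeries.coeff 0 P • Tr f := by
  rw [trAction_Tr, ← map_smul, Tr_eq_Tr_iff]
  exact seriesEval_apply_sub_mem u.toEnd_mem_fil isSumClosed_trKer (fun _ => u.toEnd_mem_trKer) P hf

theorem j_eq_trAction_div (u : TDer k n) : u.j = u.trAction (expSubOneDivX k) u.div := by
  rw [j, div, trAction_Tr, ← opSeries_eq_seriesEval]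
  simp only [expSubOneDivX, PowerSeries.coeff_mk]

theorem trAction_inv_j (u : TDer k n) : u.trAction (expSubOneDivX k)⁻¹ u.j = u.div := by
  rw [j_eq_trAction_div, ← trAction_mul_apply,
    PowerSeries.inv_mul_cancel _ constantCoeff_expSubOneDivX_ne_zero, trAction_one_apply]

theorem j_neg (u : TDer k n) : (-u).j = -(-u).trAction (PowerSeries.exp k) u.j := by
  rw [j_eq_trAction_div, j_eq_trAction_div, div_neg, map_neg, trAction_neg, trAction_neg,
    evalNegHom_expSubOneDivX, trAction_mul_apply]

end TDer

section AffineAction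

variable {k : Type*} [Field k] {n : ℕ}

/-- The action of a derivation `u` on `Ass_n = k ⊕ Ass_n⁺`, made affine by sending `1` to `d`.
With `d` of trace `div u`, these operators integrate `u` and its divergence simultaneously. -/
def affineAction (u : TDer k n) (d : Ass k n) : Module.End k (Ass k n) where
  toFun f := u.toEnd f + f [] • d
  map_add' f g := by rw [map_add, Ass.add_apply, add_smul]; abel
  map_smul' c f := by
    rw [map_smul, Ass.smul_apply, mul_smul, RingHom.id_apply, smul_add]

theorem affineAction_apply (u : TDer k n) (d f : Ass k n) :
    affineAction u d f = u.toEnd f + f [] • d := rfl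

theorem affineAction_apply_of_mem_fil (u : TDer k n) (d : Ass k n) {f : Ass k n}
    (hf : f ∈ fil k 1) : affineAction u d f = u.toEnd f := by
  rw [affineAction_apply, Ass.mem_fil_one.1 hf, zero_smul, add_zero]

theorem affineAction_mem_fil {u : TDer k n} {d : Ass k n} {m : ℕ} (hu : u.toEnd ∈ fil k m)
    (hd : d ∈ fil k m) : affineAction u d ∈ fil k m := fun p f hf => by
  refine add_mem (hu p f hf) ?_
  rcases p.eq_zero_or_pos with rfl | hp
  · exact Submodule.smul_mem _ _ (by rwa [zero_add])
  · rw [Ass.mem_fil_one.1 (fil_le hp hf), zero_smul]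
    exact zero_mem _

theorem lie_affineAction (u v : TDer k n) {d e : Ass k n} (hd : d ∈ fil k 1) (he : e ∈ fil k 1) :
    ⁅affineAction u d, affineAction v e⁆ = affineAction ⁅u, v⁆ (u.toEnd e - v.toEnd d) := by
  have happly : ∀ (u v : TDer k n) {e : Ass k n}, e ∈ fil k 1 → ∀ d f,
      affineAction u d (affineAction v e f) = u.toEnd (v.toEnd f) + f [] • u.toEnd e := by
    intro u v e he d f
    rw [affineAction_apply_of_mem_fil u d
      (end_apply_mem_fil (affineAction_mem_fil v.toEnd_mem_fil he) f), affineAction_apply, map_add,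
      map_smul]
  ext1 f
  rw [LieRing.of_associative_ring_bracket, LinearMap.sub_apply, Module.End.mul_apply,
    Module.End.mul_apply, happly u v he, happly v u hd, affineAction_apply, TDer.lie_toEnd,
    LieRing.of_associative_ring_bracket, LinearMap.sub_apply, Module.End.mul_apply,
    Module.End.mul_apply, smul_sub]
  abel

variable (k n) in
/-- The affine actions, of order at least `m`, whose translation part `d` represents the
divergence of their linear part. -/
def affineActions (m : ℕ) : Submodule k (Module.End k (Ass k n)) where
  carrier := {T | ∃ u d, u.HasOrder m ∧ d ∈ fil k (max 1 m) ∧ Tr d = u.div ∧ T = affineAction u d}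
  add_mem' := by
    rintro _ _ ⟨u, d, hu, hd, htr, rfl⟩ ⟨v, e, hv, he, htr', rfl⟩
    refine ⟨u + v, d + e, hu.add hv, add_mem hd he, ?_, LinearMap.ext fun f => ?_⟩
    · rw [map_add, htr, htr', TDer.div, TDer.div, TDer.div, TDer.divRep_add, map_add]
    · simp only [LinearMap.add_apply, affineAction_apply, TDer.add_toEnd, smul_add]
      abel
  zero_mem' := by
    refine ⟨0, 0, TDer.hasOrder_zero m, zero_mem _, ?_, LinearMap.ext fun f => ?_⟩
    · rw [TDer.div, TDer.divRep_zero]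
    · rw [affineAction_apply, TDer.zero_toEnd, smul_zero, add_zero]
  smul_mem' := by
    rintro c _ ⟨u, d, hu, hd, htr, rfl⟩
    refine ⟨c • u, c • d, hu.smul c, Submodule.smul_mem _ c hd, ?_, LinearMap.ext fun f => ?_⟩
    · rw [map_smul, htr, TDer.div, TDer.div, TDer.divRep_smul, map_smul]
    · rw [LinearMap.smul_apply, affineAction_apply, affineAction_apply, TDer.smul_toEnd,
        LinearMap.smul_apply, smul_add, smul_comm c (f [])]

theorem affineActions_le_fil (m : ℕ) : affineActions k n m ≤ fil k m := by
  rintro _ ⟨u, d, hu, hd, -, rfl⟩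
  exact affineAction_mem_fil hu.1 (fil_le (le_max_right 1 m) hd)

theorem affineAction_divRep_mem_affineActions (u : TDer k n) :
    affineAction u u.divRep ∈ affineActions k n 1 :=
  ⟨u, u.divRep, u.hasOrder_one, TDer.divRep_mem_fil u.hasOrder_one, rfl, rfl⟩

theorem lie_mem_affineActions {p q : ℕ} {S T : Module.End k (Ass k n)}
    (hS : S ∈ affineActions k n p) (hT : T ∈ affineActions k n q) :
    ⁅S, T⁆ ∈ affineActions k n (p + q) := by
  obtain ⟨u, d, hu, hd, htr, rfl⟩ := hS
  obtain ⟨v, e, hv, he, htr', rfl⟩ := hT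
  have hd1 := fil_le (le_max_left 1 p) hd
  have he1 := fil_le (le_max_left 1 q) he
  refine ⟨⁅u, v⁆, u.toEnd e - v.toEnd d, hu.lie hv, ?_, ?_, lie_affineAction u v hd1 he1⟩
  · have hu' := hu.1 _ _ he
    have hv' := hv.1 _ _ hd
    have hu1 := end_apply_mem_fil u.toEnd_mem_fil e
    have hv1 := end_apply_mem_fil v.toEnd_mem_fil d
    rcases max_choice 1 (p + q) with h | h <;> rw [h]
    · exact sub_mem hu1 hv1
    · exact sub_mem (fil_le (by omega) hu') (fil_le (by omega) hv')
  · rw [TDer.div_lie, Tr_eq_Tr_iff, sub_sub_sub_comm, ← map_sub, ← map_sub]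
    exact sub_mem (u.toEnd_mem_trKer (Tr_eq_Tr_iff.1 htr'))
      (v.toEnd_mem_trKer (Tr_eq_Tr_iff.1 htr))

variable [CharZero k]

theorem lsum_mem_affineActions {T : ℕ → Module.End k (Ass k n)}
    (hT : ∀ r, T r ∈ affineActions k n r) : lsum k T ∈ affineActions k n 1 := by
  choose u d hu hd htr hT using hT
  have hdr : ∀ r, d r ∈ fil k r := fun r => fil_le (le_max_right 1 r) (hd r)
  refine ⟨TDer.sum u hu, lsum k d, TDer.hasOrder_one _,
    lsum_mem_fil hdr fun r => fil_le (le_max_left 1 r) (hd r), ?_, LinearMap.ext fun f => ?_⟩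
  · rw [TDer.div, TDer.divRep_sum]
    exact Tr_lsum_eq_of_forall hdr (fun r => TDer.divRep_mem_fil (hu r)) htr
  · simp only [lsum_end_apply, hT, affineAction_apply, lsum_add]
    exact congrArg _ (map_smul (lsum k) (f []) d)

theorem filExp_affineAction_apply (u : TDer k n) {d : Ass k n} (hd : d ∈ fil k 1) (f : Ass k n) :
    filExp k (affineAction u d) f =
      u.exp f + f [] • seriesEval u.toEnd (expSubOneDivX k) d := by
  have hpow : ∀ g ∈ fil k 1, ∀ r, (affineAction u d ^ r) g = (u.toEnd ^ r) g := fun g hg r => by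
    induction r with
    | zero => rfl
    | succ r ih =>
      have hr : (u.toEnd ^ r) g ∈ fil k 1 :=
        fil_le (Nat.le_add_right 1 r) (pow_mem_fil u.toEnd_mem_fil r 1 g hg)
      rw [pow_succ', Module.End.mul_apply, ih, affineAction_apply_of_mem_fil u d hr, pow_succ',
        Module.End.mul_apply]
  have hmem : affineAction u d f ∈ fil k 1 :=
    end_apply_mem_fil (affineAction_mem_fil u.toEnd_mem_fil hd) f
  rw [filExp_end_apply (affineAction_mem_fil u.toEnd_mem_fil hd), seriesEval_end_apply]
  simp only [hpow _ hmem]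
  rw [← seriesEval_end_apply, affineAction_apply, map_add, map_smul, u.exp_apply]
  abel

/-- The cocycle identity for `j` is the multiplicativity of the exponentials of affine actions,
evaluated at `1`. -/
theorem TDer.exists_exp_eq_mul (u v : TDer k n) : ∃ w : TDer k n,
    w.exp = u.exp * v.exp ∧ w.j = u.j + u.trAction (PowerSeries.exp k) v.j := by
  obtain ⟨T, hT, hprod⟩ := exists_filExp_lsum_eq_mul
    (fun _ _ _ hS _ hT => lie_mem_affineActions hS hT) affineActions_le_fil
    (affineAction_divRep_mem_affineActions u) (affineAction_divRep_mem_affineActions v)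
  obtain ⟨w, d, -, hd, htr, hw⟩ := lsum_mem_affineActions hT
  have hu := TDer.divRep_mem_fil u.hasOrder_one
  have hv := TDer.divRep_mem_fil v.hasOrder_one
  have hv' := Ass.mem_fil_one.1 (seriesEval_apply_mem_fil v.toEnd_mem_fil (expSubOneDivX k) hv)
  have happly : ∀ f, w.exp f + f [] • seriesEval w.toEnd (expSubOneDivX k) d =
      u.exp (v.exp f) + f [] • (u.exp (seriesEval v.toEnd (expSubOneDivX k) v.divRep) +
        seriesEval u.toEnd (expSubOneDivX k) u.divRep) := fun f => by
    have h := LinearMap.congr_fun hprod f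
    rw [hw, Module.End.mul_apply, filExp_affineAction_apply w hd, filExp_affineAction_apply v hv,
      filExp_affineAction_apply u hu, map_add, map_smul, Ass.add_apply, v.exp_apply_nil,
      Ass.smul_apply, hv', mul_zero, add_zero] at h
    rw [h, smul_add]
    abel
  have hone : seriesEval w.toEnd (expSubOneDivX k) d =
      u.exp (seriesEval v.toEnd (expSubOneDivX k) v.divRep) +
        seriesEval u.toEnd (expSubOneDivX k) u.divRep := by
    simpa [TDer.exp_one, Ass.one_apply] using happly 1
  refine ⟨w, LinearMap.ext fun f => ?_, ?_⟩
  · have h := happly f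
    rw [hone] at h
    exact add_right_cancel h
  · rw [w.j_eq_trAction_div, ← htr, trAction_Tr, hone, map_add, ← trAction_exp_Tr, ← trAction_Tr,
      ← trAction_Tr, add_comm]
    exact congrArg₂ (· + ·) u.j_eq_trAction_div.symm
      (congrArg _ v.j_eq_trAction_div.symm)

end AffineAction

/-! ### The kernel of `δ` -/

section Substitution

variable {k : Type*} [Field k] {m n p : ℕ}

theorem wordProd_nil (s : Fin m → Ass k n) : wordProd s [] = 1 := rfl

theorem wordProd_cons (s : Fin m → Ass k n) (i : Fin m) (v : List (Fin m)) :
    wordProd s (i :: v) = s i * wordProd s v := by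
  rw [wordProd, wordProd, List.map_cons, List.prod_cons]

theorem subst_apply {s : Fin m → Ass k n} (hs : ∀ i, s i [] = 0) (f : Ass k m)
    (w : List (Fin n)) : subst s hs f w = ∑ v ∈ wordsLE m w.length, f v * wordProd s v w := rfl

theorem subst_sub_sum_mem_fil {s : Fin m → Ass k n} (hs : ∀ i, s i [] = 0) (f : Ass k m) (N : ℕ) :
    subst s hs f - ∑ v ∈ wordsLE m N, f v • wordProd s v ∈ fil k (N + 1) := by
  intro w hw
  rw [Ass.sub_apply, Ass.sum_apply, sub_eq_zero]
  exact substFun_apply hs f w (Nat.lt_succ_iff.1 hw)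

theorem map_subst (φ : Ass k n →ₗ[k] Ass k p) (hone : φ 1 = 1)
    (hmul : ∀ f g, φ (f * g) = φ f * φ g) (hfil : ∀ N, ∀ f ∈ fil k N, φ f ∈ fil k N)
    {s : Fin m → Ass k n} (hs : ∀ i, s i [] = 0) {t : Fin m → Ass k p} (ht : ∀ i, t i [] = 0)
    (hst : ∀ i, φ (s i) = t i) (f : Ass k m) : φ (subst s hs f) = subst t ht f := by
  have hword : ∀ v, φ (wordProd s v) = wordProd t v := fun v => by
    induction v with
    | nil => exact hone
    | cons a v ih => rw [wordProd_cons, wordProd_cons, hmul, ih, hst]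
  refine eq_of_sub_mem_fil k fun N => fil_le N.le_succ ?_
  have happrox := hfil _ _ (subst_sub_sum_mem_fil hs f N)
  simp only [map_sub, map_sum, map_smul, hword] at happrox
  simpa only [sub_sub_sub_cancel_right] using sub_mem happrox (subst_sub_sum_mem_fil ht f N)

theorem derivation_subst_eq_zero {D : Module.End k (Ass k n)}
    (hleibniz : ∀ f g, D (f * g) = D f * g + f * D g) (hD : D ∈ fil k 0) {s : Fin m → Ass k n}
    (hs : ∀ i, s i [] = 0) (h : ∀ i, D (s i) = 0) (f : Ass k m) : D (subst s hs f) = 0 := by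
  have hword : ∀ v, D (wordProd s v) = 0 := fun v => by
    induction v with
    | nil => simpa only [mul_one, one_mul, left_eq_add, wordProd_nil] using hleibniz 1 1
    | cons a v ih => rw [wordProd_cons, hleibniz, ih, h, zero_mul, mul_zero, add_zero]
  refine eq_zero_of_mem_fil (k := k) fun N => fil_le N.le_succ ?_
  have happrox := hD _ _ (subst_sub_sum_mem_fil hs f N)
  simpa only [map_sub, map_sum, map_smul, hword, smul_zero, Finset.sum_const_zero, sub_zero]
    using happrox

theorem wordProd_letters_apply {s : Fin m → Ass k n} {S : Finset (Fin n)} {ρ : Fin n → Fin m}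
    (h : ∀ i, s i = ∑ j ∈ S, if ρ j = i then X j else 0) (v : List (Fin m)) (w : List (Fin n)) :
    wordProd s v w = if (∀ j ∈ w, j ∈ S) ∧ w.map ρ = v then 1 else 0 := by
  induction v generalizing w with
  | nil => cases w <;> simp [wordProd_nil, Ass.one_apply]
  | cons i v ih =>
    have hmul : s i * wordProd s v =
        ∑ l ∈ S, (if ρ l = i then 1 else 0 : k) • (X l * wordProd s v) := by
      rw [h, Finset.sum_mul]
      exact Finset.sum_congr rfl fun l _ => by split_ifs <;> simp
    rw [wordProd_cons, hmul, Ass.sum_apply]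
    cases w with
    | nil => simp only [Ass.smul_apply, Ass.mul_nil, X_nil, zero_mul, mul_zero,
        Finset.sum_const_zero, List.map_nil, reduceCtorEq, and_false, if_false]
    | cons j w =>
      simp only [Ass.smul_apply, X_mul_cons, ih, mul_ite _ _ (_ : k) 0, mul_zero]
      rw [Finset.sum_ite_eq']
      by_cases hj : j ∈ S <;> by_cases hi : ρ j = i <;> simp [hj, hi]

theorem subst_letters_apply {s : Fin m → Ass k n} (hs : ∀ i, s i [] = 0) {S : Finset (Fin n)}
    {ρ : Fin n → Fin m} (h : ∀ i, s i = ∑ j ∈ S, if ρ j = i then X j else 0) (f : Ass k m)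
    (w : List (Fin n)) : subst s hs f w = if ∀ j ∈ w, j ∈ S then f (w.map ρ) else 0 := by
  simp only [subst_apply, wordProd_letters_apply h]
  split_ifs with hS
  · have hmem : w.map ρ ∈ wordsLE m w.length := mem_wordsLE.2 (by rw [List.length_map])
    simp only [and_iff_right hS, mul_ite, mul_one, mul_zero]
    rw [Finset.sum_ite_eq, if_pos hmem]
  · exact Finset.sum_eq_zero fun v _ => by rw [if_neg fun hv => hS hv.1, mul_zero]

theorem cyc_subst_letters {s : Fin m → Ass k n} (hs : ∀ i, s i [] = 0) (S : Finset (Fin n))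
    (ρ : Fin n → Fin m) (h : ∀ i, s i = ∑ j ∈ S, if ρ j = i then X j else 0) (f : Ass k m)
    (w : List (Fin n)) :
    cyc (subst s hs f) w = if ∀ j ∈ w, j ∈ S then cyc f (w.map ρ) else 0 := by
  simp only [cyc_apply, subst_letters_apply hs h, List.mem_rotate, List.length_map,
    List.map_rotate]
  split_ifs
  · rfl
  · exact Finset.sum_const_zero

theorem cyc_rotate (f : Ass k n) (w : List (Fin n)) (j : ℕ) : cyc f (w.rotate j) = cyc f w := by
  simp only [cyc_apply, List.length_rotate, List.rotate_rotate]
  rw [← sum_rotate_add f w j]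
  simp only [add_comm]

theorem trMap_Tr (φ : Ass k m →ₐ[k] Ass k n) (f : Ass k m) : trMap φ (Tr f) = Tr (φ f) := rfl

end Substitution

section Cocycles

variable (k : Type*) [Field k]

/-- The variant of `δ̃` in which `ch(x, y)` is replaced by `x + y`, so that `δ` vanishes on its
image: `f ↦ f(y) - f(x + y) + f(x)`. -/
def addCoboundary : tr k 1 →ₗ[k] tr k 2 :=
  trMap (subst ![X 1] (by simp [X_nil])) - trMap (subst ![X 0 + X 1] (by simp [X_nil]))
    + trMap (subst ![X 0] (by simp [X_nil]))

variable {k} [CharZero k]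

theorem Tr_eq_addCoboundary_Tr_iff {f : Ass k 2} {h : Ass k 1} :
    Tr f = addCoboundary k (Tr h) ↔ ∀ w : List (Fin 2), cyc f w =
      ((if ∀ j ∈ w, j = 1 then 1 else 0) - 1 + (if ∀ j ∈ w, j = 0 then 1 else 0)) *
        (w.length * h (List.replicate w.length 0)) := by
  have hcyc : ∀ w : List (Fin 2), cyc h (w.map fun _ => 0) =
      w.length * h (List.replicate w.length 0) := fun w => by simp [cyc_apply]
  simp only [addCoboundary, LinearMap.sub_apply, LinearMap.add_apply, trMap_Tr]
  rw [← map_sub, ← map_add, Tr_eq_Tr_iff, mem_trKer_iff_cyc_eq_zero, map_sub, sub_eq_zero,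
    Ass.ext_iff, funext_iff]
  refine forall_congr' fun w => ?_
  rw [map_add, map_sub, Ass.add_apply, Ass.sub_apply,
    cyc_subst_letters _ {1} (fun _ => 0) (by simp [Fin.forall_fin_one]),
    cyc_subst_letters _ Finset.univ (fun _ => 0) (by simp [Fin.forall_fin_one]),
    cyc_subst_letters _ {0} (fun _ => 0) (by simp [Fin.forall_fin_one])]
  simp only [hcyc, Finset.mem_singleton, Finset.mem_univ, implies_true, if_true, add_mul, sub_mul,
    ite_mul, one_mul, zero_mul]

theorem delta_Tr_eq_zero_iff {f : Ass k 2} : delta k (Tr f) = 0 ↔ ∀ w : List (Fin 3),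
    (if ∀ j ∈ w, j ≠ 0 then cyc f (w.map ![0, 0, 1]) else 0) - cyc f (w.map ![0, 0, 1]) +
      cyc f (w.map ![0, 1, 1]) - (if ∀ j ∈ w, j ≠ 2 then cyc f (w.map ![0, 1, 1]) else 0) = 0 := by
  simp only [delta, LinearMap.sub_apply, LinearMap.add_apply, trMap_Tr]
  rw [← map_sub, ← map_add, ← map_sub, Tr_eq_zero_iff, mem_trKer_iff_cyc_eq_zero, Ass.ext_iff,
    funext_iff]
  refine forall_congr' fun w => ?_
  rw [map_sub, map_add, map_sub, Ass.sub_apply, Ass.add_apply, Ass.sub_apply,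
    cyc_subst_letters _ {1, 2} ![0, 0, 1] (by simp [Fin.forall_fin_two]),
    cyc_subst_letters _ Finset.univ ![0, 0, 1]
      (by simp [Fin.forall_fin_two, Fin.sum_univ_three]),
    cyc_subst_letters _ Finset.univ ![0, 1, 1]
      (by simp [Fin.forall_fin_two, Fin.sum_univ_three]),
    cyc_subst_letters _ {0, 1} ![0, 1, 1] (by simp [Fin.forall_fin_two])]
  have hmem_yz : ∀ j : Fin 3, j ∈ ({1, 2} : Finset (Fin 3)) ↔ j ≠ 0 := by decide
  have hmem_xy : ∀ j : Fin 3, j ∈ ({0, 1} : Finset (Fin 3)) ↔ j ≠ 2 := by decide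
  simp only [hmem_yz, hmem_xy, Finset.mem_univ, implies_true, if_true, Ass.zero_apply]

theorem delta_addCoboundary (t : tr k 1) : delta k (addCoboundary k t) = 0 := by
  obtain ⟨h, rfl⟩ := Tr_surjective t
  obtain ⟨f, hf⟩ := Tr_surjective (addCoboundary k (Tr h))
  rw [← hf, delta_Tr_eq_zero_iff]
  intro w
  have hxy_one : ∀ j : Fin 3, (![0, 0, 1] : Fin 3 → Fin 2) j = 1 ↔ j = 2 := by decide
  have hxy_zero : ∀ j : Fin 3, (![0, 0, 1] : Fin 3 → Fin 2) j = 0 ↔ j ≠ 2 := by decide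
  have hyz_one : ∀ j : Fin 3, (![0, 1, 1] : Fin 3 → Fin 2) j = 1 ↔ j ≠ 0 := by decide
  have hyz_zero : ∀ j : Fin 3, (![0, 1, 1] : Fin 3 → Fin 2) j = 0 ↔ j = 0 := by decide
  simp only [Tr_eq_addCoboundary_Tr_iff.1 hf, List.forall_mem_map, List.length_map, hxy_one,
    hxy_zero, hyz_one, hyz_zero]
  have hz : (∀ j ∈ w, j = 2) → ∀ j ∈ w, j ≠ 0 := fun h j hj => by rw [h j hj]; decide
  have hx : (∀ j ∈ w, j = 0) → ∀ j ∈ w, j ≠ 2 := fun h j hj => by rw [h j hj]; decide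
  split_ifs <;> first
    | ring1
    | exact absurd (hz ‹_›) ‹_›
    | exact absurd (hx ‹_›) ‹_›

section Exactness

variable {f : Ass k 2}

theorem cyc_append_one_of_delta_eq_zero (hf : delta k (Tr f) = 0) (v : List (Fin 2)) :
    cyc f (v ++ [1]) = (1 - if ∀ j ∈ v, j = 1 then 1 else 0) *
      cyc f (List.replicate v.length 0 ++ [1]) := by
  have hmap_left : (v.map ![(0 : Fin 3), 1] ++ [2]).map ![0, 0, 1] =
      List.replicate v.length (0 : Fin 2) ++ [1] := by
    rw [List.map_append, List.map_map, ← List.map_const']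
    exact congrArg (· ++ [1]) (List.map_congr_left fun j _ => by fin_cases j <;> rfl)
  have hmap_right : (v.map ![(0 : Fin 3), 1] ++ [2]).map ![0, 1, 1] = v ++ [(1 : Fin 2)] := by
    rw [List.map_append, List.map_map]
    exact congrArg (· ++ [1]) ((List.map_congr_left fun j _ => by
      fin_cases j <;> rfl).trans v.map_id)
  have hne_zero : (∀ j ∈ v.map ![(0 : Fin 3), 1] ++ [2], j ≠ 0) ↔ ∀ j ∈ v, j = 1 := by
    have hletter : ∀ j : Fin 2, ![(0 : Fin 3), 1] j ≠ 0 ↔ j = 1 := by decide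
    simp only [List.forall_mem_append, List.forall_mem_map, hletter, List.forall_mem_singleton]
    exact and_iff_left (by decide)
  have hne_two : ¬ ∀ j ∈ v.map ![(0 : Fin 3), 1] ++ [2], j ≠ 2 := fun h => h 2 (by simp) rfl
  -- the coefficient of the word `v z`
  have hcocycle := delta_Tr_eq_zero_iff.1 hf (v.map ![0, 1] ++ [2])
  rw [hmap_left, hmap_right, if_neg hne_two, sub_zero] at hcocycle
  simp only [hne_zero] at hcocycle
  split_ifs at hcocycle ⊢ <;> linear_combination hcocycle

theorem cyc_replicate_zero_of_delta_eq_zero (hf : delta k (Tr f) = 0) (d : ℕ) :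
    cyc f (List.replicate (d + 1) 0) = 0 := by
  have hcocycle := delta_Tr_eq_zero_iff.1 hf (List.replicate (d + 1) 0)
  rw [if_neg fun h => h 0 (by simp) rfl, if_pos fun j hj => by
    rw [List.eq_of_mem_replicate hj]; decide] at hcocycle
  simpa using hcocycle

theorem cyc_apply_of_delta_eq_zero (hf : delta k (Tr f) = 0) {w : List (Fin 2)} (hw : w ≠ []) :
    cyc f w =
      (1 - (if ∀ j ∈ w, j = 1 then 1 else 0) - (if ∀ j ∈ w, j = 0 then 1 else 0)) *
        cyc f (List.replicate (w.length - 1) 0 ++ [1]) := by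
  by_cases hmem : (1 : Fin 2) ∈ w
  · obtain ⟨a, b, rfl⟩ := List.append_of_mem hmem
    have hrotate : (a ++ 1 :: b).rotate (a ++ [1]).length = (b ++ a) ++ [1] := by
      rw [List.append_cons, List.rotate_append_length_eq, List.append_assoc]
    have hzero : ¬ ∀ j ∈ a ++ 1 :: b, j = 0 := fun h => one_ne_zero (h 1 hmem)
    have hone : (∀ j ∈ b ++ a, j = 1) ↔ ∀ j ∈ a ++ 1 :: b, j = 1 := by
      simp only [List.forall_mem_append, List.forall_mem_cons, true_and]
      exact and_comm
    have hlength : (b ++ a).length = (a ++ 1 :: b).length - 1 := by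
      simp only [List.length_append, List.length_cons]; omega
    rw [← cyc_rotate f _ (a ++ [1]).length, hrotate, cyc_append_one_of_delta_eq_zero hf, hlength,
      if_neg hzero, sub_zero]
    simp only [hone]
  · have hzero : ∀ j ∈ w, j = 0 := fun j hj => by
      have hj1 : j ≠ 1 := fun h => hmem (h ▸ hj)
      omega
    have hone : ¬ ∀ j ∈ w, j = 1 := fun h => by
      obtain ⟨j, hj⟩ := List.exists_mem_of_ne_nil w hw
      exact hmem (h j hj ▸ hj)
    rw [if_neg hone, if_pos hzero, sub_zero, sub_self, zero_mul, List.eq_replicate_of_mem hzero,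
      ← Nat.sub_add_cancel (List.length_pos_iff.2 hw), cyc_replicate_zero_of_delta_eq_zero hf]

theorem exists_addCoboundary_eq_of_delta_eq_zero (hf : delta k (Tr f) = 0) :
    ∃ h : Ass k 1, Tr f = addCoboundary k (Tr h) := by
  refine ⟨⟨fun v => -((v.length : k)⁻¹ * cyc f (List.replicate (v.length - 1) 0 ++ [1]))⟩,
    Tr_eq_addCoboundary_Tr_iff.2 fun w => ?_⟩
  by_cases hw : w = []
  · subst hw
    simp [cyc_apply]
  · have hlength : (w.length : k) ≠ 0 := Nat.cast_ne_zero.2 (by simpa using hw)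
    rw [cyc_apply_of_delta_eq_zero hf hw]
    simp only [List.length_replicate, mul_neg, mul_inv_cancel_left₀ hlength]
    ring

end Exactness

theorem ker_delta : LinearMap.ker (delta k) = LinearMap.range (addCoboundary k) := by
  refine le_antisymm (fun t ht => ?_) ?_
  · obtain ⟨f, rfl⟩ := Tr_surjective t
    obtain ⟨h, hh⟩ := exists_addCoboundary_eq_of_delta_eq_zero (LinearMap.mem_ker.1 ht)
    exact ⟨Tr h, hh.symm⟩
  · rintro _ ⟨t, rfl⟩
    exact delta_addCoboundary t

end Cocycles

namespace TDer

variable {k : Type*} [Field k]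

theorem toEnd_subst_X_mem_trKer {n : ℕ} (u : TDer k n) (i : Fin n) (h : Ass k 1) :
    u.toEnd (subst ![X i] (by simp [X_nil]) h) ∈ trKer k n := by
  -- `u` and the inner derivation of `u.comp i` agree at `X i`, hence on the series in `X i`
  set D : Module.End k (Ass k n) :=
    u.toEnd - (LinearMap.mulRight k (u.comp i) - LinearMap.mulLeft k (u.comp i)) with hD
  have hD_apply : ∀ f, D f = u.toEnd f - (f * u.comp i - u.comp i * f) := fun f => by simp [hD]
  have hleibniz : ∀ f g, D (f * g) = D f * g + f * D g := fun f g => by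
    simp only [hD_apply, u.leibniz]
    noncomm_ring
  have hfil : D ∈ fil k 0 := fun p f hf => by
    rw [hD_apply, add_zero]
    refine sub_mem (fil_le p.le_succ (u.toEnd_mem_fil p f hf)) (sub_mem ?_ ?_)
    · simpa only [add_zero] using mul_mem_fil (k := k) hf (u.comp i).mem_fil_zero
    · simpa only [zero_add] using mul_mem_fil (k := k) (u.comp i).mem_fil_zero hf
  have hzero := derivation_subst_eq_zero hleibniz hfil (s := ![X i]) (by simp [X_nil])
    (fun l => by rw [Fin.fin_one_eq_zero l, Matrix.cons_val_zero, hD_apply, u.map_X, sub_self]) h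
  rw [hD_apply, sub_eq_zero] at hzero
  exact hzero ▸ commutator_mem_trKer _ _

variable [CharZero k]

theorem trAction_trMap_subst_X {n : ℕ} (u : TDer k n) (P : k⟦X⟧) (i : Fin n) (t : tr k 1) :
    u.trAction P (trMap (subst ![X i] (by simp [X_nil])) t) =
      PowerSeries.coeff 0 P • trMap (subst ![X i] (by simp [X_nil])) t := by
  obtain ⟨h, rfl⟩ := Tr_surjective t
  exact u.trAction_Tr_of_toEnd_mem_trKer P (u.toEnd_subst_X_mem_trKer i h)

theorem trAction_addCoboundary_of_mem_sder2 {u : TDer k 2} (hu : u ∈ sder2 k) (P : k⟦X⟧)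
    (t : tr k 1) :
    u.trAction P (addCoboundary k t) = PowerSeries.coeff 0 P • addCoboundary k t := by
  have hsum : u.trAction P (trMap (subst ![X 0 + X 1] (by simp [X_nil])) t) =
      PowerSeries.coeff 0 P • trMap (subst ![X 0 + X 1] (by simp [X_nil])) t := by
    obtain ⟨h, rfl⟩ := Tr_surjective t
    refine u.trAction_Tr_of_toEnd_mem_trKer P ?_
    have hzero := derivation_subst_eq_zero u.leibniz (fil_le zero_le_one u.toEnd_mem_fil)
      (s := ![X 0 + X 1]) (by simp [X_nil]) (fun l => by rw [Fin.fin_one_eq_zero l]; exact hu) h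
    exact hzero ▸ zero_mem _
  simp only [addCoboundary, LinearMap.add_apply, LinearMap.sub_apply, map_add, map_sub, hsum,
    trAction_trMap_subst_X, smul_add, smul_sub]

theorem trAction_exp_addCoboundary {u : TDer k 2} (hu : u.exp (X 0 + X 1) = ch k) (t : tr k 1) :
    u.trAction (PowerSeries.exp k) (addCoboundary k t) = deltaTilde k t := by
  have hsum : u.trAction (PowerSeries.exp k) (trMap (subst ![X 0 + X 1] (by simp [X_nil])) t) =
      trMap (subst ![ch k] (by simp [ch_nil])) t := by
    obtain ⟨h, rfl⟩ := Tr_surjective t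
    rw [trMap_Tr, trMap_Tr, trAction_exp_Tr]
    refine congrArg Tr (map_subst u.exp u.exp_one u.exp_mul u.exp_mem_fil _ _
      (fun l => ?_) h)
    rw [Fin.fin_one_eq_zero l]
    exact hu
  have hX := u.trAction_trMap_subst_X (PowerSeries.exp k)
  simp only [addCoboundary, deltaTilde, LinearMap.add_apply, LinearMap.sub_apply, map_add, map_sub,
    hsum, hX, PowerSeries.coeff_zero_eq_constantCoeff_apply, PowerSeries.constantCoeff_exp,
    one_smul]

end TDer

/-! ### The torsor of solutions -/

section Main

variable {k : Type*} [Field k] [CharZero k]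

theorem mem_HKV2_iff {G : Module.End k (Ass k 2)} : G ∈ HKV2 k ↔
    ∃ u : TDer k 2, u.exp = G ∧ u ∈ sder2 k ∧ u.j ∈ LinearMap.range (addCoboundary k) := by
  have hinv : PowerSeries.coeff 0 (expSubOneDivX k)⁻¹ = 1 := by
    rw [PowerSeries.coeff_zero_eq_constantCoeff_apply, PowerSeries.constantCoeff_inv,
      ← PowerSeries.coeff_zero_eq_constantCoeff_apply, coeff_zero_expSubOneDivX, inv_one]
  constructor
  · rintro ⟨u, ⟨hu, hdiv⟩, rfl⟩
    rw [ker_delta] at hdiv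
    obtain ⟨t, ht⟩ := hdiv
    refine ⟨u, rfl, hu, t, ?_⟩
    rw [u.j_eq_trAction_div, ← ht, TDer.trAction_addCoboundary_of_mem_sder2 hu,
      coeff_zero_expSubOneDivX, one_smul]
  · rintro ⟨u, rfl, hu, t, ht⟩
    refine ⟨u, ⟨hu, ?_⟩, rfl⟩
    rw [ker_delta, ← u.trAction_inv_j, ← ht, TDer.trAction_addCoboundary_of_mem_sder2 hu, hinv,
      one_smul]
    exact LinearMap.mem_range_self _ t

theorem exp_mem_HKV2 {u : TDer k 2} (hu : u.exp (X 0 + X 1) = X 0 + X 1)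
    (hj : u.j ∈ LinearMap.range (addCoboundary k)) : u.exp ∈ HKV2 k :=
  mem_HKV2_iff.2 ⟨u, rfl, TDer.toEnd_eq_zero_of_exp_apply_eq hu, hj⟩

theorem TDer.trAction_exp_addCoboundary_of_mem_sder2 {u : TDer k 2} (hu : u ∈ sder2 k)
    (t : tr k 1) : u.trAction (PowerSeries.exp k) (addCoboundary k t) = addCoboundary k t := by
  rw [trAction_addCoboundary_of_mem_sder2 hu, PowerSeries.coeff_zero_eq_constantCoeff_apply,
    PowerSeries.constantCoeff_exp, one_smul]

theorem mul_mem_HKV2 {F G : Module.End k (Ass k 2)} (hF : F ∈ HKV2 k) (hG : G ∈ HKV2 k) :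
    F * G ∈ HKV2 k := by
  obtain ⟨u, rfl, hu, s, hs⟩ := mem_HKV2_iff.1 hF
  obtain ⟨v, rfl, hv, t, ht⟩ := mem_HKV2_iff.1 hG
  obtain ⟨w, hw, hj⟩ := TDer.exists_exp_eq_mul u v
  rw [← hw]
  refine exp_mem_HKV2 ?_ ⟨s + t, ?_⟩
  · rw [hw, Module.End.mul_apply, TDer.exp_apply_of_toEnd_eq_zero hv,
      TDer.exp_apply_of_toEnd_eq_zero hu]
  · rw [hj, ← hs, ← ht, TDer.trAction_exp_addCoboundary_of_mem_sder2 hu, map_add]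

theorem exp_neg_mem_HKV2 {u : TDer k 2} (hu : u ∈ sder2 k)
    (hj : u.j ∈ LinearMap.range (addCoboundary k)) : (-u).exp ∈ HKV2 k := by
  have hneg : -u ∈ sder2 k := by
    rw [sder2, Set.mem_ofPred_eq, TDer.neg_toEnd, LinearMap.neg_apply, neg_eq_zero]
    exact hu
  obtain ⟨t, ht⟩ := hj
  refine mem_HKV2_iff.2 ⟨-u, rfl, hneg, -t, ?_⟩
  rw [u.j_neg, ← ht, TDer.trAction_exp_addCoboundary_of_mem_sder2 hneg, map_neg]

theorem one_mem_HKV2 : (1 : Module.End k (Ass k 2)) ∈ HKV2 k := by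
  refine ⟨0, ⟨rfl, ?_⟩, LinearMap.ext fun f => TDer.exp_apply_of_toEnd_eq_zero rfl⟩
  rw [TDer.div, TDer.divRep_zero, map_zero]
  exact zero_mem _

variable (k) in
/-- `HKV_2` as a group of automorphisms. -/
def HKV2Subgroup : Subgroup (Module.End k (Ass k 2))ˣ where
  carrier := {g | (g : Module.End k (Ass k 2)) ∈ HKV2 k}
  mul_mem' := mul_mem_HKV2
  one_mem' := one_mem_HKV2
  inv_mem' {g} hg := by
    obtain ⟨u, hu, hsder, hj⟩ := mem_HKV2_iff.1 hg
    rw [show g = u.expUnit from Units.ext hu.symm]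
    exact exp_neg_mem_HKV2 hsder hj

theorem coe_image_HKV2Subgroup :
    Units.val '' (HKV2Subgroup k : Set (Module.End k (Ass k 2))ˣ) = HKV2 k := by
  refine Set.Subset.antisymm ?_ ?_
  · rintro _ ⟨g, hg, rfl⟩
    exact hg
  · rintro _ ⟨u, hu, rfl⟩
    exact ⟨u.expUnit, ⟨u, hu, rfl⟩, rfl⟩

theorem isUnit_of_mem_SolHKV {F : Module.End k (Ass k 2)} (hF : F ∈ SolHKV k) : IsUnit F := by
  obtain ⟨u, rfl, -⟩ := hF
  exact u.expUnit.isUnit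

theorem mul_mem_SolHKV {F G : Module.End k (Ass k 2)} (hF : F ∈ SolHKV k) (hG : G ∈ HKV2 k) :
    F * G ∈ SolHKV k := by
  obtain ⟨u, rfl, hu, s, hs⟩ := hF
  obtain ⟨v, rfl, hv, t, ht⟩ := mem_HKV2_iff.1 hG
  obtain ⟨w, hw, hj⟩ := TDer.exists_exp_eq_mul u v
  refine ⟨w, hw.symm, ?_, s + t, ?_⟩
  · rw [Module.End.mul_apply, TDer.exp_apply_of_toEnd_eq_zero hv, hu]
  · rw [hj, ← ht, TDer.trAction_exp_addCoboundary hu, ← hs, map_add]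

theorem exists_mem_HKV2_mul_eq {F G : Module.End k (Ass k 2)} (hF : F ∈ SolHKV k)
    (hG : G ∈ SolHKV k) : ∃ g ∈ HKV2 k, F * g = G := by
  obtain ⟨u, rfl, hu, s, hs⟩ := hF
  obtain ⟨v, rfl, hv, t, ht⟩ := hG
  obtain ⟨w, hw, hj⟩ := TDer.exists_exp_eq_mul (-u) v
  refine ⟨w.exp, exp_mem_HKV2 ?_ ⟨t - s, ?_⟩, ?_⟩
  · rw [hw, Module.End.mul_apply, hv, ← hu, ← Module.End.mul_apply, u.exp_neg_mul_exp,
      Module.End.one_apply]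
  · have hdiff : u.trAction (PowerSeries.exp k) (addCoboundary k (t - s)) = v.j - u.j := by
      rw [TDer.trAction_exp_addCoboundary hu, map_sub, hs, ht]
    rw [hj, u.j_neg, neg_add_eq_sub, ← map_sub, ← hdiff, u.trAction_exp_neg_trAction_exp]
  · rw [hw, ← mul_assoc, u.exp_mul_exp_neg, one_mul]

instance : MulAction (HKV2Subgroup k)ᵐᵒᵖ (SolHKV k) where
  smul g F := ⟨F * (g.unop : (Module.End k (Ass k 2))ˣ), mul_mem_SolHKV F.2 g.unop.2⟩
  one_smul F := Subtype.ext (mul_one F.1)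
  mul_smul _ _ F := Subtype.ext (mul_assoc F.1 _ _).symm

theorem coe_op_smul (g : HKV2Subgroup k) (F : SolHKV k) :
    ((MulOpposite.op g • F : SolHKV k) : Module.End k (Ass k 2)) =
      F * (g : (Module.End k (Ass k 2))ˣ) := rfl

theorem eq_one_of_op_smul_eq {g : HKV2Subgroup k} {F : SolHKV k}
    (h : MulOpposite.op g • F = F) : g = 1 := by
  have hmul : (F : Module.End k (Ass k 2)) * (g : (Module.End k (Ass k 2))ˣ) = F * 1 := by
    rw [← coe_op_smul, h, mul_one]
  exact Subtype.ext (Units.ext ((isUnit_of_mem_SolHKV F.2).mul_left_cancel hmul))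

theorem exists_op_smul_eq (F₁ F₂ : SolHKV k) :
    ∃ g : HKV2Subgroup k, MulOpposite.op g • F₁ = F₂ := by
  obtain ⟨G, hG, h⟩ := exists_mem_HKV2_mul_eq F₁.2 F₂.2
  rw [← coe_image_HKV2Subgroup] at hG
  obtain ⟨g, hg, rfl⟩ := hG
  exact ⟨⟨g, hg⟩, Subtype.ext h⟩

end Main

end KashiwaraVergne

end

theorem mainTheorem3 (k : Type*) [Field k] [CharZero k]
    (hne : (KashiwaraVergne.SolHKV k).Nonempty) :
    ∃ H : Subgroup (Module.End k (KashiwaraVergne.Ass k 2))ˣ,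
      Units.val '' (H : Set (Module.End k (KashiwaraVergne.Ass k 2))ˣ) = KashiwaraVergne.HKV2 k ∧
      ∃ _act : MulAction (↥H)ᵐᵒᵖ (KashiwaraVergne.SolHKV k),
        (∀ (g : H) (F : KashiwaraVergne.SolHKV k),
          ((MulOpposite.op g • F : KashiwaraVergne.SolHKV k) :
              Module.End k (KashiwaraVergne.Ass k 2)) =
            (F : Module.End k (KashiwaraVergne.Ass k 2)) *
              ((g : (Module.End k (KashiwaraVergne.Ass k 2))ˣ) :
                Module.End k (KashiwaraVergne.Ass k 2))) ∧
        (∀ (g : H) (F : KashiwaraVergne.SolHKV k), MulOpposite.op g • F = F → g = 1) ∧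
        (∀ F₁ F₂ : KashiwaraVergne.SolHKV k, ∃ g : H, MulOpposite.op g • F₁ = F₂) := by
  exact ⟨KashiwaraVergne.HKV2Subgroup k, KashiwaraVergne.coe_image_HKV2Subgroup, inferInstance,
    KashiwaraVergne.coe_op_smul, fun _ _ => KashiwaraVergne.eq_one_of_op_smul_eq,
    KashiwaraVergne.exists_op_smul_eq⟩
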